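/- For an integer $d\ge 2$ let $\mathcal A_d=\{1-d,3-d,\dots,d-3,d-1\}$ and let $(e_p)_{p\in\mathcal A_d}$ be the canonical basis of $\mathbb C^{\mathcal A_d}$. For $\alpha\in(0,\frac12)$ put $\rho=e^{2\pi i\alpha}$, $\zeta=\rho^{-1}$. For $p\in\mathcal A_d$ let $L_p\in GL(\mathbb C^{\mathcal A_d})$ be given by $$L_p(e_q)=\begin{cases} e_q-e_p & q>p,\\ e_q-\zeta e_p & q<p,\\ -\zeta e_p & q=p,\end{cases}$$ and let $Q_\alpha$ be the hermitian form on $\mathbb C^{\mathcal A_d}$ (linear in the first variable) with $Q_\alpha(e_p,e_p)=1$ for all $p$ and $Q_\alpha(e_p,e_{p'})=(1+\zeta)^{-1}$ for $p>p'$. Let $SU(Q_\alpha)$ be the group of complex linear automorphisms of determinant $1$ preserving $Q_\alpha$. A subset $S\subseteq SU(Q_\alpha)$ is called Zariski dense in $SU(Q_\alpha)$ if every polynomial with real coefficients in the real and imaginary parts of the matrix entries that vanishes on $S$ vanishes on $SU(Q_\alpha)$. (i) Let $\alpha=\frac14$ and $d=4$. The intersection with $SL(\mathbb C^{\mathcal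 A_4})$ of the group generated by $L_{-3},L_{-1},L_1,L_3$ is contained in $SU(Q_{1/4})$ and Zariski dense in it. Moreover $Q_{1/4}$ has signature $(3,1)$, i.e. some linear isomorphism $\mathbb C^{\mathcal A_4}\to\mathbb C^{4}$ carries $Q_{1/4}$ to the standard form of signature $(3,1)$, and conjugation by it is an isomorphism $SU(Q_{1/4})\cong SU(3,1)$. (ii) Let $\alpha=\frac16$ and $d=6$. The intersection with $SL(\mathbb C^{\mathcal A_6})$ of the group generated by $L_{-5},L_{-3},L_{-1},L_1,L_3,L_5$ is contained in $SU(Q_{1/6})$ and Zariski dense in it. Moreover $Q_{1/6}$ has signature $(5,1)$, and a linear isomorphism $\mathbb C^{\mathcal A_6}\to\mathbb C^{6}$ carrying $Q_{1/6}$ to the standard form of signature $(5,1)$ induces by conjugation an isomorphism $SU(Q_{1/6})\cong SU(5,1)$. -/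

import Mathlib

namespace VeechMcMullen

open Matrix

/-- The index set `𝒜_d = {1 - d, 3 - d, …, d - 1}` (step `2`, hence `d` elements). -/
def A (d : ℕ) : Finset ℤ :=
  (Finset.range d).image fun j : ℕ => 2 * (j : ℤ) + 1 - (d : ℤ)

theorem A_four : A 4 = {-3, -1, 1, 3} := by decide

theorem A_six : A 6 = {-5, -3, -1, 1, 3, 5} := by decide

/-- `ρ = exp (2 π i α)`. -/
noncomputable def rho (α : ℝ) : ℂ := Complex.exp (2 * Real.pi * α * Complex.I)

/-- `ζ = ρ⁻¹`. -/
noncomputable def zeta (α : ℝ) : ℂ := (rho α)⁻¹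

/-- The canonical basis vector `e_p` of `ℂ^{𝒜_d}`. -/
def e {d : ℕ} (p : A d) : A d → ℂ := Pi.single p 1

/-- The matrix of `L_p`, whose column `q` is `L_p (e_q)`. -/
noncomputable def Lmat (α : ℝ) {d : ℕ} (p : A d) : Matrix (A d) (A d) ℂ :=
  Matrix.of fun r q =>
    (if p < q then e q - e p
      else if q < p then e q - zeta α • e p
      else -(zeta α • e p)) r

/-- The matrix of the inverse of `L_p`: exchange `ζ` and `ρ`, and reverse the order. -/
noncomputable def LmatInv (α : ℝ) {d : ℕ} (p : A d) : Matrix (A d) (A d) ℂ :=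
  Matrix.of fun r q =>
    (if q < p then e q - e p
      else if p < q then e q - rho α • e p
      else -(rho α • e p)) r

theorem zeta_mul_rho (α : ℝ) : zeta α * rho α = 1 :=
  inv_mul_cancel₀ (Complex.exp_ne_zero _)

/-- Left multiplication by a matrix that differs from the identity in the row `p` only. -/
theorem one_sub_row_mul {d : ℕ} (p : A d) (c c' : A d → ℂ)
    (h : ∀ q, c q + c' q = c p * c' q) :
    (Matrix.of fun r q => e q r - c q * e p r : Matrix (A d) (A d) ℂ) *
      (Matrix.of fun r q => e q r - c' q * e p r) = 1 := by
  ext r q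
  have h1 := h q
  simp only [mul_apply, of_apply, mul_sub, sub_mul, Finset.sum_sub_distrib, e, Pi.single_apply,
    one_apply, mul_ite, ite_mul, mul_one, one_mul, mul_zero, zero_mul,
    Finset.sum_ite_eq', Finset.mem_univ, if_true]
  split_ifs <;> first | rfl | linear_combination -h1 | linear_combination h1 | simp_all

theorem Lmat_eq (α : ℝ) {d : ℕ} (p : A d) :
    Lmat α p = Matrix.of fun r q =>
      e q r - (if p < q then 1 else if q < p then zeta α else 1 + zeta α) * e p r := by
  ext r q
  rcases lt_trichotomy p q with h | h | h
  · simp [Lmat, h]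
  · subst h
    simp [Lmat]
    ring
  · simp [Lmat, h, h.not_gt]

theorem LmatInv_eq (α : ℝ) {d : ℕ} (p : A d) :
    LmatInv α p = Matrix.of fun r q =>
      e q r - (if q < p then 1 else if p < q then rho α else 1 + rho α) * e p r := by
  ext r q
  rcases lt_trichotomy p q with h | h | h
  · simp [LmatInv, h, h.not_gt]
  · subst h
    simp [LmatInv]
    ring
  · simp [LmatInv, h]

theorem Lmat_mul_LmatInv (α : ℝ) {d : ℕ} (p : A d) : Lmat α p * LmatInv α p = 1 := by
  rw [Lmat_eq, LmatInv_eq]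
  refine one_sub_row_mul p _ _ fun q => ?_
  have hz := zeta_mul_rho α
  rcases lt_trichotomy p q with h | h | h
  · simp only [h, h.not_gt, lt_irrefl, if_true, if_false]
    linear_combination -hz
  · subst h
    simp only [lt_irrefl, if_false]
    linear_combination -hz
  · simp only [h, h.not_gt, lt_irrefl, if_true, if_false]
    ring

/-- `L_p` as an element of `GL(ℂ^{𝒜_d})`. -/
noncomputable def L (α : ℝ) {d : ℕ} (p : A d) : GL (A d) ℂ where
  val := Lmat α p
  inv := LmatInv α p
  val_inv := Lmat_mul_LmatInv α p
  inv_val := mul_eq_one_comm.mp (Lmat_mul_LmatInv α p)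

/-- The subgroup of `GL(ℂ^{𝒜_d})` generated by all the `L_p`, `p ∈ 𝒜_d`. -/
noncomputable def Gam (α : ℝ) (d : ℕ) : Subgroup (GL (A d) ℂ) :=
  Subgroup.closure (Set.range fun p : A d => L α p)

/-- The entries `Q_α(e_p, e_q)`. -/
noncomputable def gram (α : ℝ) {d : ℕ} (p q : A d) : ℂ :=
  if p = q then 1
  else if q < p then (1 + zeta α)⁻¹
  else (starRingEnd ℂ) (1 + zeta α)⁻¹

/-- The hermitian form `Q_α` on `ℂ^{𝒜_d}`, linear in the first variable and conjugate-linear in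
the second one. -/
noncomputable def Q (α : ℝ) (d : ℕ) (x y : A d → ℂ) : ℂ :=
  ∑ p, ∑ q, x p * (starRingEnd ℂ) (y q) * gram α p q

/-- The standard hermitian form of signature `(m, n)` on `ℂ^{m + n}`. -/
def stdForm (m n : ℕ) (x y : Fin m ⊕ Fin n → ℂ) : ℂ :=
  ∑ i, x (Sum.inl i) * (starRingEnd ℂ) (y (Sum.inl i)) -
    ∑ j, x (Sum.inr j) * (starRingEnd ℂ) (y (Sum.inr j))

section

variable {ι : Type*} [Fintype ι] [DecidableEq ι]

/-- The special unitary group of a form `B` on `ℂ^ι`. -/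
def SU (B : (ι → ℂ) → (ι → ℂ) → ℂ) : Subgroup (GL ι ℂ) where
  carrier := {g | (∀ x y, B (g.1 *ᵥ x) (g.1 *ᵥ y) = B x y) ∧ g.1.det = 1}
  one_mem' := by simp
  mul_mem' := by
    rintro g h ⟨hg, hg'⟩ ⟨hh, hh'⟩
    refine ⟨fun x y => ?_, by simp [hg', hh']⟩
    rw [Units.val_mul, ← mulVec_mulVec, ← mulVec_mulVec, hg, hh]
  inv_mem' := by
    rintro g ⟨hg, hg'⟩
    refine ⟨fun x y => ?_, ?_⟩
    · rw [← hg, mulVec_mulVec, mulVec_mulVec, Units.mul_inv, one_mulVec, one_mulVec]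
    · have h : (g.1 * (g⁻¹).1).det = 1 := by simp
      rwa [det_mul, hg', one_mul] at h

/-- The real coordinates (real and imaginary parts of the entries) of a complex matrix. -/
def realCoords (M : Matrix ι ι ℂ) : (ι × ι) ⊕ (ι × ι) → ℝ :=
  Sum.elim (fun ij => (M ij.1 ij.2).re) (fun ij => (M ij.1 ij.2).im)

/-- `S` is Zariski dense in `T`, for the Zariski topology of real algebraic geometry: `S ⊆ T` and
every real polynomial in the real and imaginary parts of the entries that vanishes on `S`
vanishes on `T`. -/
def IsZariskiDenseIn (S T : Set (GL ι ℂ)) : Prop :=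
  S ⊆ T ∧
    ∀ f : MvPolynomial ((ι × ι) ⊕ (ι × ι)) ℝ,
      (∀ g ∈ S, MvPolynomial.eval (realCoords g.1) f = 0) →
        ∀ g ∈ T, MvPolynomial.eval (realCoords g.1) f = 0

end

/-- The form `B` is equivalent to the standard form of signature `(m, n)`, and the change of
coordinates carries `SU(B)` isomorphically onto `SU(m, n)`. -/
def IsStandardSU {ι : Type*} [Fintype ι] [DecidableEq ι] (B : (ι → ℂ) → (ι → ℂ) → ℂ)
    (m n : ℕ) : Prop :=
  ∃ φ : (ι → ℂ) ≃ₗ[ℂ] (Fin m ⊕ Fin n → ℂ),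
    (∀ x y, B x y = stdForm m n (φ x) (φ y)) ∧
    ∃ Ψ : SU B ≃* SU (stdForm m n),
      ∀ (g : SU B) (x : ι → ℂ), φ (g.1.1 *ᵥ x) = (Ψ g).1.1 *ᵥ φ x

end VeechMcMullen

/-!
Both cases are instances of one fact about `α = 1 / d` for an arbitrary `d = m + 1 ≥ 3`
(`isZariskiDenseIn_and_isStandardSU`), and the proof rests on the unitary transvections
`x ↦ x + i t B(x, v) v` along isotropic vectors `v` (`transv`).

*Transvections in `Γ`.* Each `L_p` is a complex reflection for `Q_α`. Number `𝒜_d` increasingly by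
`0, …, m`. The product of the reflections numbered `0, …, m - 1` is, up to the factor `ζ`, almost
a cyclic shift of `d` numbers attached to a vector (`coord_prodL_pow`). As `ζ ^ d = 1`, its `d`-th
power is unipotent, and it turns out to be the transvection along `v = (1, ρ, …, ρ^{m-1}, 0)` with
`t = 2 Im ρ ≠ 0` (`toLin'_prodL_pow`). A real polynomial that vanishes on the powers of a
transvection vanishes on its whole real one-parameter group (`transv_mem_zariskiClosure`), so the
Zariski closure of `Γ ∩ SL` contains the one-parameter groups of transvections along all the
vectors of the orbit `Γ v`, and this orbit spans the space (`span_nullVectors`).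

*From some transvections to all of them.* Let `X` be the set of isotropic vectors whose
transvections belong to the Zariski closure. If `v, w ∈ X` are not orthogonal, then all isotropic
vectors of the plane of `v` and `w` are in `X`. For a form of signature `(m, 1)`, fix a hyperbolic
pair `v, w` in `X`. The isotropic vectors not orthogonal to `v` are, up to scalars and to the
action of transvections along `v`, parametrised by their component orthogonal to `v, w`; by the
property of planes, the components that come from `X` form a complex subspace. As `X` spans, this
subspace is everything, so `X` contains all isotropic vectors (`mem_nullVectors_of_span`).

*Generation.* For such a form the special unitary group is generated by transvections
(`mem_transvMonoid_of_det_eq_one`): transvections generate `SL₂(ℝ)` on each hyperbolic plane,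
hence the Eichler transformations, and these move any unit vector to a given one. So an isometry
can be corrected by transvections until it moves only a hyperbolic plane.

*Signature.* The Gram matrix of `Q_α` is a twisted circulant matrix. The geometric progressions
whose ratio `μ` satisfies `μ ^ d = ζ` form an orthogonal basis of eigenvectors (`formQ_geom`), and
exactly one of the eigenvalues, which are quotients of sines, is negative (`exists_equiv_formQ`).
-/

namespace VeechMcMullen

open Complex ComplexConjugate Matrix

/-! ### Unitary transvections generate the special unitary group -/

section Transvections

variable {V : Type*} [AddCommGroup V] [Module ℂ V]

/-- The unitary transvection `x ↦ x + i t B(x, v) v`. It preserves the hermitian form `B` when `v`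
is isotropic. -/
noncomputable def transv (B : V →ₗ[ℂ] V →ₗ⋆[ℂ] ℂ) (v : V) (t : ℝ) : Module.End ℂ V :=
  1 + ((t : ℂ) * I) • (B.flip v).smulRight v

theorem transv_apply (B : V →ₗ[ℂ] V →ₗ⋆[ℂ] ℂ) (v : V) (t : ℝ) (x : V) :
    transv B v t x = x + (t * I * B x v) • v := by
  simp [transv, smul_smul]

/-- The monoid generated by the unitary transvections along isotropic vectors. -/
noncomputable def transvMonoid (B : V →ₗ[ℂ] V →ₗ⋆[ℂ] ℂ) : Submonoid (Module.End ℂ V) :=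
  Submonoid.closure {g | ∃ v t, B v v = 0 ∧ g = transv B v t}

variable {B : V →ₗ[ℂ] V →ₗ⋆[ℂ] ℂ}

theorem transv_mem {v : V} (hv : B v v = 0) (t : ℝ) : transv B v t ∈ transvMonoid B :=
  Submonoid.subset_closure ⟨v, t, hv, rfl⟩

theorem transv_zero (v : V) : transv B v 0 = 1 := by
  ext x; simp [transv_apply]

theorem transv_mul {v : V} (hv : B v v = 0) (s t : ℝ) :
    transv B v s * transv B v t = transv B v (s + t) := by
  ext x
  simp only [Module.End.mul_apply, transv_apply, map_add, map_smul, hv, ofReal_add]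
  module

theorem transv_pow {v : V} (hv : B v v = 0) (t : ℝ) (n : ℕ) :
    transv B v t ^ n = transv B v (n * t) := by
  induction n with
  | zero => simp [transv_zero]
  | succ n ih => rw [pow_succ, ih, transv_mul hv]; congr 1; push_cast; ring

theorem transv_smul (c : ℂ) (v : V) (t : ℝ) :
    transv B (c • v) t = transv B v (t * normSq c) := by
  ext x
  simp only [transv_apply, LinearMap.map_smulₛₗ, smul_eq_mul, smul_smul, ofReal_mul,
    normSq_eq_conj_mul_self]
  module

theorem transv_isometry (hB : ∀ x y, conj (B x y) = B y x) {v : V} (hv : B v v = 0) (t : ℝ)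
    (x y : V) : B (transv B v t x) (transv B v t y) = B x y := by
  simp only [transv_apply, map_add, map_smul, LinearMap.add_apply, LinearMap.smul_apply,
    LinearMap.map_smulₛₗ, smul_eq_mul, map_mul, conj_I, conj_ofReal, hB, hv]
  ring

theorem transvMonoid_isometry (hB : ∀ x y, conj (B x y) = B y x) {g : Module.End ℂ V}
    (hg : g ∈ transvMonoid B) (x y : V) : B (g x) (g y) = B x y := by
  induction hg using Submonoid.closure_induction generalizing x y with
  | mem g hg => obtain ⟨v, t, hv, rfl⟩ := hg; exact transv_isometry hB hv t x y
  | one => rfl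
  | mul g h _ _ hg hh => rw [Module.End.mul_apply, Module.End.mul_apply, hg, hh]

theorem exists_mul_eq_one_of_mem_transvMonoid {g : Module.End ℂ V} (hg : g ∈ transvMonoid B) :
    ∃ h ∈ transvMonoid B, h * g = 1 := by
  induction hg using Submonoid.closure_induction with
  | mem g hg =>
    obtain ⟨v, t, hv, rfl⟩ := hg
    exact ⟨_, transv_mem hv (-t), by rw [transv_mul hv, neg_add_cancel, transv_zero]⟩
  | one => exact ⟨1, one_mem _, one_mul _⟩
  | mul g h _ _ hg hh =>
    obtain ⟨g', hg', e⟩ := hg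
    obtain ⟨h', hh', e'⟩ := hh
    exact ⟨h' * g', mul_mem hh' hg', by
      rw [mul_assoc, ← mul_assoc g', e, one_mul, e']⟩

/-- An isometry `g` conjugates the transvections along `v` to those along `g v`. -/
theorem mul_transv_mul {g h : Module.End ℂ V} (hg : ∀ x y, B (g x) (g y) = B x y) (hgh : g * h = 1)
    (v : V) (t : ℝ) : g * transv B v t * h = transv B (g v) t := by
  ext x
  have hx : g (h x) = x := by rw [← Module.End.mul_apply, hgh, Module.End.one_apply]
  have : B (h x) v = B x (g v) := by rw [← hg, hx]
  simp [transv_apply, hx, this]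

/-- The group `SL₂(ℝ)` acting on a hyperbolic plane is generated by transvections: with respect to
the basis `v`, `i w` the map below has the real matrix with rows `(a, -c)` and `(b, d)`. -/
theorem plane_mem_transvMonoid {v w : V} (hv : B v v = 0) (hw : B w w = 0) (hvw : B v w = 1)
    (hwv : B w v = 1) {a b c d : ℝ} (hdet : a * d + b * c = 1) {g : Module.End ℂ V}
    (hg : ∀ x, g x = x + B x w • (((a : ℂ) - 1) • v + (b * I : ℂ) • w) +
      B x v • ((c * I : ℂ) • v + ((d : ℂ) - 1) • w)) :
    g ∈ transvMonoid B := by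
  have key : ∀ {a b c d : ℝ}, a * d + b * c = 1 → b ≠ 0 → ∀ {g : Module.End ℂ V},
      (∀ x, g x = x + B x w • (((a : ℂ) - 1) • v + (b * I : ℂ) • w) +
        B x v • ((c * I : ℂ) • v + ((d : ℂ) - 1) • w)) → g ∈ transvMonoid B := by
    intro a b c d hdet hb g hg
    have e : g = transv B v ((1 - a) / b) * transv B w b * transv B v ((1 - d) / b) := by
      obtain ⟨s, hs⟩ : ∃ s, s = (1 - a) / b := ⟨_, rfl⟩
      obtain ⟨t, ht⟩ : ∃ t, t = (1 - d) / b := ⟨_, rfl⟩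
      rw [← hs, ← ht]
      have ha : a = 1 - s * b := by rw [hs]; field_simp; ring
      have hd : d = 1 - t * b := by rw [ht]; field_simp; ring
      have hc : c = s + t - s * t * b := by
        have : b * c = b * (s + t - s * t * b) := by rw [ha, hd] at hdet; linear_combination hdet
        exact mul_left_cancel₀ hb this
      ext x
      rw [hg]
      simp only [Module.End.mul_apply, transv_apply, map_add, map_smul, hv, hvw, hwv, ha, hd, hc]
      push_cast
      match_scalars <;> ring_nf <;> (simp only [I_sq, I_pow_three]; ring)
    rw [e]
    exact mul_mem (mul_mem (transv_mem hv _) (transv_mem hw _)) (transv_mem hv _)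
  by_cases hb : b = 0
  · subst hb
    have ha : a ≠ 0 := by rintro rfl; simp at hdet
    have h1 : transv B w 1 * g ∈ transvMonoid B := by
      refine key (a := a) (b := a) (c := c) (d := d - c) (by linear_combination hdet) ha
        fun x => ?_
      simp only [Module.End.mul_apply, hg, transv_apply, map_add, map_smul, hw, hvw]
      push_cast
      match_scalars <;> ring_nf
      simp only [I_sq]
      ring
    have : g = transv B w (-1) * (transv B w 1 * g) := by
      rw [← mul_assoc, transv_mul hw, neg_add_cancel, transv_zero, one_mul]
    rw [this]
    exact mul_mem (transv_mem hw _) h1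
  · exact key hdet hb hg

/-- The Eichler transformation attached to an isotropic vector `v` and a vector `u ⟂ v`. -/
noncomputable def eichler (B : V →ₗ[ℂ] V →ₗ⋆[ℂ] ℂ) (v u : V) : Module.End ℂ V :=
  1 + (B.flip v).smulRight u - (B.flip u).smulRight v - (B u u / 2) • (B.flip v).smulRight v

theorem eichler_apply (v u x : V) :
    eichler B v u x = x + B x v • u - B x u • v - (B u u / 2 * B x v) • v := by
  simp [eichler, smul_smul]

/-- The Eichler transformation `E` along `v` is `D D'`, where `D` scales the hyperbolic pair `v, w`
by `2, 1/2` and `D'` scales the hyperbolic pair `v, E w` by `1/2, 2`. -/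
theorem eichler_mem_transvMonoid (hB : ∀ x y, conj (B x y) = B y x) {v w u : V} (hv : B v v = 0)
    (hw : B w w = 0) (hvw : B v w = 1) (huv : B u v = 0) (huw : B u w = 0) :
    eichler B v u ∈ transvMonoid B := by
  have hwv : B w v = 1 := by rw [← hB, hvw, map_one]
  have hvu : B v u = 0 := by rw [← hB, huv, map_zero]
  have hwu : B w u = 0 := by rw [← hB, huw, map_zero]
  have huu : conj (B u u) = B u u := hB u u
  obtain ⟨w', hw'⟩ : ∃ w', w' = w + u - (B u u / 2) • v := ⟨_, rfl⟩
  let D : Module.End ℂ V := 1 + (B.flip w).smulRight v - (1 / 2 : ℂ) • (B.flip v).smulRight w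
  let D' : Module.End ℂ V := 1 - (1 / 2 : ℂ) • (B.flip w').smulRight v + (B.flip v).smulRight w'
  have hD : D ∈ transvMonoid B := by
    refine plane_mem_transvMonoid hv hw hvw hwv (a := 2) (b := 0) (c := 0) (d := 1 / 2)
      (by norm_num) fun x => ?_
    simp only [D, LinearMap.add_apply, LinearMap.sub_apply, LinearMap.smul_apply,
      LinearMap.smulRight_apply, LinearMap.flip_apply, Module.End.one_apply]
    push_cast
    module
  have hD' : D' ∈ transvMonoid B := by
    have h2 : (starRingEnd ℂ) 2 = 2 := Complex.conj_ofNat 2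
    refine plane_mem_transvMonoid hv (w := w') ?_ ?_ ?_ (a := 1 / 2) (b := 0) (c := 0) (d := 2)
      (by norm_num) fun x => ?_
    · simp only [hw', map_add, map_sub, LinearMap.map_smulₛₗ, LinearMap.add_apply,
        LinearMap.sub_apply, LinearMap.smul_apply, hv, hw, hvw, hwv, huv, huw, hvu, hwu, huu,
        map_div₀, h2, smul_eq_mul, RingHom.id_apply]
      ring
    · simp [hw', hv, hvw, hvu]
    · simp [hw', hv, hwv, huv]
    · simp only [D', LinearMap.add_apply, LinearMap.sub_apply, LinearMap.smul_apply,
        LinearMap.smulRight_apply, LinearMap.flip_apply, Module.End.one_apply]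
      push_cast
      module
  have e : eichler B v u = D * D' := by
    have h2 : (starRingEnd ℂ) 2 = 2 := Complex.conj_ofNat 2
    ext x
    simp only [eichler_apply, D, D', Module.End.mul_apply, LinearMap.add_apply,
      LinearMap.sub_apply, LinearMap.smul_apply, LinearMap.smulRight_apply, LinearMap.flip_apply,
      Module.End.one_apply, hw', map_add, map_sub, map_smul, LinearMap.map_smulₛₗ, hv, hw, hvw,
      hwv, huv, huw, huu, map_div₀, h2, smul_eq_mul]
    module
  rw [e]
  exact mul_mem hD hD'

theorem eichler_fix {v u y : V} (hyv : B y v = 0) (hyu : B y u = 0) : eichler B v u y = y := by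
  simp [eichler_apply, hyv, hyu]

/-- Unit vectors can be moved to a given unit vector `u` orthogonal to a hyperbolic pair `v, w` by
transvections, without moving what is orthogonal to all the vectors involved. -/
theorem exists_transv_unit (hB : ∀ x y, conj (B x y) = B y x) {v w u x : V} (hv : B v v = 0)
    (hw : B w w = 0) (hvw : B v w = 1) (huv : B u v = 0) (huw : B u w = 0) (hu : B u u = 1)
    (hx : B x x = 1) :
    ∃ g ∈ transvMonoid B, g x = u ∧
      ∀ y, B y v = 0 → B y w = 0 → B y x = 0 → B y u = 0 → g y = y := by
  have hwv : B w v = 1 := by rw [← hB, hvw, map_one]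
  have hvu : B v u = 0 := by rw [← hB, huv, map_zero]
  have hwu : B w u = 0 := by rw [← hB, huw, map_zero]
  -- the vectors that are not orthogonal to `v`
  have key : ∀ x, B x x = 1 → B x v ≠ 0 → ∃ g ∈ transvMonoid B, g x = u ∧
      ∀ y, B y v = 0 → B y w = 0 → B y x = 0 → B y u = 0 → g y = y := by
    intro x hx hxv
    obtain ⟨b, hb⟩ : ∃ b, b = B x v := ⟨_, rfl⟩
    rw [← hb] at hxv
    obtain ⟨u', hu'⟩ : ∃ u', u' = b⁻¹ • (u - (x - b • w - B x w • v)) := ⟨_, rfl⟩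
    have hu'v : B u' v = 0 := by simp [hu', huv, hwv, hv, ← hb]
    have hu'w : B u' w = 0 := by simp [hu', huw, hvw, hw]
    have hE := eichler_mem_transvMonoid hB hv hw hvw hu'v hu'w
    -- `E x` is `b w + u` up to a multiple of `v`
    obtain ⟨a, ha⟩ : ∃ a, eichler B v u' x = a • v + b • w + u := by
      refine ⟨B x w - B x u' - B u' u' / 2 * b, ?_⟩
      have : b • u' = u - (x - b • w - B x w • v) := by rw [hu', smul_smul, mul_inv_cancel₀ hxv,
        one_smul]
      rw [eichler_apply, ← hb, this]
      module
    have hre : a * conj b + b * conj a = 0 := by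
      have h := transvMonoid_isometry hB hE x x
      rw [ha, hx] at h
      simp only [map_add, map_smul, LinearMap.add_apply, LinearMap.smul_apply,
        LinearMap.map_smulₛₗ, smul_eq_mul, hv, hw, hvw, hwv, huv, huw, hvu, hwu, hu] at h
      linear_combination h
    obtain ⟨t, ht⟩ : ∃ t : ℝ, a + t * I * b = 0 := by
      refine ⟨(I * a / b).re, ?_⟩
      have hcb : conj b ≠ 0 := by simpa using hxv
      have : (((I * a / b).re : ℝ) : ℂ) = I * a / b := by
        rw [← conj_eq_iff_re, map_div₀, map_mul, conj_I]
        field_simp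
        linear_combination -hre
      rw [this]
      field_simp
      linear_combination a * I_sq
    have hF := eichler_mem_transvMonoid hB (u := conj b • u) hw hv hwv (by simp [huw])
      (by simp [huv])
    refine ⟨_, mul_mem hF (mul_mem (transv_mem hv t) hE), ?_, fun y hyv hyw hyx hyu => ?_⟩
    · have h1 : transv B v t (a • v + b • w + u) = b • w + u := by
        have : B (a • v + b • w + u) v = b := by simp [hv, hwv, huv]
        have h2 : transv B v t (a • v + b • w + u) = (a + t * I * b) • v + b • w + u := by
          rw [transv_apply, this]
          module
        rw [h2, ht, zero_smul, zero_add]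
      rw [Module.End.mul_apply, Module.End.mul_apply, ha, h1, eichler_apply]
      simp [hw, huw, hwu, hu]
    · have h1 : eichler B v u' y = y := eichler_fix hyv (by
        simp [hu', LinearMap.map_smulₛₗ, hyu, hyx, hyw, hyv])
      rw [Module.End.mul_apply, Module.End.mul_apply, h1, transv_apply, hyv, mul_zero, zero_smul,
        add_zero]
      exact eichler_fix hyw (by simp [hyu])
  by_cases hxv : B x v = 0
  · -- a preliminary move makes `x` not orthogonal to `v`
    obtain ⟨h, hh, hhx, hfix⟩ : ∃ h ∈ transvMonoid B, B (h x) v ≠ 0 ∧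
        ∀ y, B y w = 0 → B y x = 0 → h y = y ∧ B y (h x) = 0 := by
      by_cases hxw : B x w = 0
      · refine ⟨_, eichler_mem_transvMonoid hB hw hv hwv hxw hxv, ?_, fun y hyw hyx => ?_⟩
        · simp [eichler_apply, hxv, hxw, hx, hwv]
        · simp [eichler_apply, hyw, hyx, hxw, hx]
      · refine ⟨_, transv_mem hw 1, ?_, fun y hyw hyx => ?_⟩
        · simp [transv_apply, hxv, hxw, hwv]
        · simp [transv_apply, hyw, hyx, LinearMap.map_smulₛₗ]
    obtain ⟨g, hg, hgx, hgfix⟩ := key (h x) (by rw [transvMonoid_isometry hB hh, hx]) hhx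
    refine ⟨g * h, mul_mem hg hh, hgx, fun y hyv hyw hyx hyu => ?_⟩
    obtain ⟨h1, h2⟩ := hfix y hyw hyx
    rw [Module.End.mul_apply, h1, hgfix y hyv hyw h2 hyu]
  · exact key x hx hxv

theorem det_one_add_comp_comm {W : Type*} [AddCommGroup W] [Module ℂ W] [FiniteDimensional ℂ V]
    [FiniteDimensional ℂ W] (f : W →ₗ[ℂ] V) (h : V →ₗ[ℂ] W) :
    LinearMap.det (1 + f ∘ₗ h) = LinearMap.det (1 + h ∘ₗ f) := by
  classical
  let b := Module.finBasis ℂ V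
  let c := Module.finBasis ℂ W
  rw [← LinearMap.det_toMatrix b, ← LinearMap.det_toMatrix c, map_add, map_add,
    LinearMap.toMatrix_one, LinearMap.toMatrix_one, LinearMap.toMatrix_comp b c b,
    LinearMap.toMatrix_comp c b c, Matrix.det_one_add_mul_comm]

theorem det_transv [FiniteDimensional ℂ V] {v : V} (hv : B v v = 0) (t : ℝ) :
    LinearMap.det (transv B v t) = 1 := by
  have h := det_one_add_comp_comm (((t : ℂ) * I) • LinearMap.toSpanSingleton ℂ V v) (B.flip v)
  have e : transv B v t =
      1 + (((t : ℂ) * I) • LinearMap.toSpanSingleton ℂ V v) ∘ₗ B.flip v := by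
    ext x; simp [transv_apply, smul_smul]
  have e' : (1 : Module.End ℂ ℂ) +
      B.flip v ∘ₗ (((t : ℂ) * I) • LinearMap.toSpanSingleton ℂ V v) = 1 := by
    ext; simp [hv]
  rw [e, h, e', map_one]

theorem det_of_mem_transvMonoid [FiniteDimensional ℂ V] {g : Module.End ℂ V}
    (hg : g ∈ transvMonoid B) : LinearMap.det g = 1 := by
  induction hg using Submonoid.closure_induction with
  | mem g hg => obtain ⟨v, t, hv, rfl⟩ := hg; exact det_transv hv t
  | one => exact map_one _
  | mul g h _ _ hg hh => rw [map_mul, hg, hh, one_mul]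

/-- An isometry of determinant one that moves only a hyperbolic plane is a product of
transvections. -/
theorem mem_transvMonoid_of_fix [FiniteDimensional ℂ V] (hB : ∀ x y, conj (B x y) = B y x)
    {v w : V} (hv : B v v = 0) (hw : B w w = 0) (hvw : B v w = 1) {g : Module.End ℂ V}
    (hg : ∀ x y, B (g x) (g y) = B x y) (hdet : LinearMap.det g = 1)
    (hspan : ∀ x, (∀ y, B y v = 0 → B y w = 0 → B x y = 0) → x = B x w • v + B x v • w)
    (hfix : ∀ y, B y v = 0 → B y w = 0 → g y = y) : g ∈ transvMonoid B := by
  have hwv : B w v = 1 := by rw [← hB, hvw, map_one]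
  obtain ⟨a, ha⟩ : ∃ a, a = B (g v) w := ⟨_, rfl⟩
  obtain ⟨b, hb⟩ : ∃ b, b = B (g v) v := ⟨_, rfl⟩
  obtain ⟨c, hc⟩ : ∃ c, c = B (g w) w := ⟨_, rfl⟩
  obtain ⟨d, hd⟩ : ∃ d, d = B (g w) v := ⟨_, rfl⟩
  have hgv : g v = a • v + b • w := by
    rw [ha, hb]
    refine hspan _ fun y hyv hyw => ?_
    rw [← hfix y hyv hyw, hg, ← hB, hyv, map_zero]
  have hgw : g w = c • v + d • w := by
    rw [hc, hd]
    refine hspan _ fun y hyv hyw => ?_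
    rw [← hfix y hyv hyw, hg, ← hB, hyw, map_zero]
  have hgx : ∀ x, g x = x + B x w • ((a - 1) • v + b • w) + B x v • (c • v + (d - 1) • w) := by
    intro x
    have h := hfix (x - B x w • v - B x v • w) (by simp [hv, hwv]) (by simp [hw, hvw])
    rw [map_sub, map_sub, map_smul, map_smul, hgv, hgw] at h
    rw [sub_sub, sub_eq_iff_eq_add] at h
    rw [h]
    module
  have hdet' : a * d - b * c = 1 := by
    let f : (Fin 2 → ℂ) →ₗ[ℂ] V :=
      (LinearMap.proj 0).smulRight ((a - 1) • v + b • w) +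
        (LinearMap.proj 1).smulRight (c • v + (d - 1) • w)
    let h : V →ₗ[ℂ] (Fin 2 → ℂ) := LinearMap.pi ![B.flip w, B.flip v]
    have e : g = 1 + f ∘ₗ h := by
      ext x
      rw [hgx]
      simp [f, h]
      module
    rw [e, det_one_add_comp_comm, ← LinearMap.det_toMatrix', Matrix.det_fin_two] at hdet
    simp [f, h, LinearMap.toMatrix'_apply, hv, hw, hvw, hwv] at hdet
    linear_combination hdet
  have h1 : a * conj b + b * conj a = 0 := by
    have h := hg v v
    rw [hgv] at h
    simp only [map_add, map_smul, LinearMap.add_apply, LinearMap.smul_apply,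
      LinearMap.map_smulₛₗ, smul_eq_mul, hv, hw, hvw, hwv] at h
    linear_combination h
  have h2 : c * conj d + d * conj c = 0 := by
    have h := hg w w
    rw [hgw] at h
    simp only [map_add, map_smul, LinearMap.add_apply, LinearMap.smul_apply,
      LinearMap.map_smulₛₗ, smul_eq_mul, hv, hw, hvw, hwv] at h
    linear_combination h
  have h3 : a * conj d + b * conj c = 1 := by
    have h := hg v w
    rw [hgv, hgw] at h
    simp only [map_add, map_smul, LinearMap.add_apply, LinearMap.smul_apply,
      LinearMap.map_smulₛₗ, smul_eq_mul, hv, hw, hvw, hwv] at h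
    linear_combination h
  have h3' : conj a * d + conj b * c = 1 := by simpa using congrArg conj h3
  -- unitarity and the determinant force the matrix of `g` in the basis `v`, `i w` to be real
  have ha' : conj a = a := by linear_combination a * h3' - conj a * hdet' - c * h1
  have hd' : conj d = d := by linear_combination d * h3 - conj d * hdet' - b * h2
  have hb' : conj b = -b := by linear_combination -b * h3' - conj b * hdet' + d * h1
  have hc' : conj c = -c := by linear_combination -c * h3 - conj c * hdet' + a * h2
  rw [conj_eq_iff_re] at ha' hd'
  have him : ∀ z : ℂ, conj z = -z → z = (z.im : ℂ) * I := fun z hz => by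
    have := congrArg re hz
    simp only [conj_re, neg_re] at this
    apply Complex.ext <;> simp
    linarith
  have hb'' := him b hb'
  have hc'' := him c hc'
  refine plane_mem_transvMonoid hv hw hvw hwv (a := a.re) (b := b.im) (c := c.im) (d := d.re) ?_
    fun x => ?_
  · have : ((a.re * d.re + b.im * c.im : ℝ) : ℂ) = 1 := by
      push_cast
      rw [ha', hd', ← hdet']
      linear_combination c * hb'' + b.im * I * hc'' + (b.im * c.im : ℂ) * I_sq
    exact_mod_cast this
  · rw [hgx, ha', hd', ← hb'', ← hc'']

/-- The special unitary group of a nondegenerate hermitian form is generated by its unitary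
transvections, if the form has an orthogonal basis of one hyperbolic pair `v, w` and unit
vectors `u i`. -/
theorem mem_transvMonoid_of_det_eq_one [FiniteDimensional ℂ V]
    (hB : ∀ x y, conj (B x y) = B y x) {v w : V} (hv : B v v = 0) (hw : B w w = 0)
    (hvw : B v w = 1) {n : ℕ} (u : Fin n → V) (huv : ∀ i, B (u i) v = 0)
    (huw : ∀ i, B (u i) w = 0) (hu : ∀ i, B (u i) (u i) = 1)
    (huu : ∀ i j, i ≠ j → B (u i) (u j) = 0)
    (hspan : ∀ x, x = B x w • v + B x v • w + ∑ i, B x (u i) • u i) {g : Module.End ℂ V}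
    (hg : ∀ x y, B (g x) (g y) = B x y) (hdet : LinearMap.det g = 1) : g ∈ transvMonoid B := by
  have hwv : B w v = 1 := by rw [← hB, hvw, map_one]
  have hvu : ∀ i, B v (u i) = 0 := fun i => by rw [← hB, huv, map_zero]
  have hwu : ∀ i, B w (u i) = 0 := fun i => by rw [← hB, huw, map_zero]
  -- the unit vectors are put back in place one after the other
  have step : ∀ k ≤ n, ∃ t ∈ transvMonoid B, ∀ i : Fin n, i.1 < k → t (g (u i)) = u i := by
    intro k
    induction k with
    | zero => exact fun _ => ⟨1, one_mem _, fun i hi => absurd hi (Nat.not_lt_zero _)⟩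
    | succ k ih =>
      intro hk
      obtain ⟨t, ht, htu⟩ := ih (by omega)
      have hiso := transvMonoid_isometry hB ht
      obtain ⟨s, hs, hsx, hsfix⟩ := exists_transv_unit hB (x := t (g (u ⟨k, hk⟩))) hv hw hvw
        (huv ⟨k, hk⟩) (huw ⟨k, hk⟩) (hu ⟨k, hk⟩) (by rw [hiso, hg, hu])
      refine ⟨s * t, mul_mem hs ht, fun i hi => ?_⟩
      rw [Module.End.mul_apply]
      rcases Nat.lt_succ_iff_lt_or_eq.mp hi with hi | hi
      · have hne : i ≠ ⟨k, hk⟩ := fun h => by simp [h] at hi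
        rw [htu i hi]
        refine hsfix _ (huv i) (huw i) ?_ (huu _ _ hne)
        nth_rw 1 [← htu i hi]
        rw [hiso, hg, huu _ _ hne]
      · have : i = ⟨k, hk⟩ := Fin.ext hi
        rw [this, hsx]
  obtain ⟨t, ht, htu⟩ := step n le_rfl
  obtain ⟨s, hs, hst⟩ := exists_mul_eq_one_of_mem_transvMonoid ht
  have htg : t * g ∈ transvMonoid B := by
    refine mem_transvMonoid_of_fix hB hv hw hvw
      (fun x y => by rw [Module.End.mul_apply, Module.End.mul_apply,
        transvMonoid_isometry hB ht, hg])
      (by rw [map_mul, hdet, det_of_mem_transvMonoid ht, one_mul]) (fun x hx => ?_)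
      fun y hyv hyw => ?_
    · conv_lhs => rw [hspan x]
      simp [fun i => hx (u i) (huv i) (huw i)]
    · rw [hspan y, hyv, hyw]
      simp [htu]
  rw [← one_mul g, ← hst, mul_assoc]
  exact mul_mem hs htg

end Transvections

/-! ### Isotropic vectors whose transvections lie in a monoid -/

section NullVectors

variable {V : Type*} [AddCommGroup V] [Module ℂ V]

/-- The isotropic vectors all of whose transvections belong to `Z`. -/
def nullVectors (B : V →ₗ[ℂ] V →ₗ⋆[ℂ] ℂ) (Z : Submonoid (Module.End ℂ V)) : Set V :=
  {v | B v v = 0 ∧ ∀ t, transv B v t ∈ Z}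

variable {B : V →ₗ[ℂ] V →ₗ⋆[ℂ] ℂ} {Z : Submonoid (Module.End ℂ V)}

theorem smul_mem_nullVectors {v : V} (hv : v ∈ nullVectors B Z) (c : ℂ) :
    c • v ∈ nullVectors B Z :=
  ⟨by simp [hv.1], fun t => by rw [transv_smul]; exact hv.2 _⟩

theorem transv_mem_nullVectors (hB : ∀ x y, conj (B x y) = B y x) {v w : V}
    (hv : v ∈ nullVectors B Z) (hw : w ∈ nullVectors B Z) (s : ℝ) :
    transv B w s v ∈ nullVectors B Z := by
  refine ⟨by rw [transv_isometry hB hw.1, hv.1], fun t => ?_⟩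
  rw [← mul_transv_mul (h := transv B w (-s)) (transv_isometry hB hw.1 s)
    (by rw [transv_mul hw.1, add_neg_cancel, transv_zero])]
  exact mul_mem (mul_mem (hw.2 _) (hv.2 _)) (hw.2 _)

/-- The set `nullVectors` contains all isotropic vectors of the plane spanned by any two of its
elements that are not orthogonal. -/
theorem smul_add_smul_mem_nullVectors (hB : ∀ x y, conj (B x y) = B y x) {v w : V}
    (hv : v ∈ nullVectors B Z) (hw : w ∈ nullVectors B Z) (hvw : B v w ≠ 0) {a b : ℂ}
    (hab : B (a • v + b • w) (a • v + b • w) = 0) : a • v + b • w ∈ nullVectors B Z := by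
  by_cases ha : a = 0
  · simpa [ha] using smul_mem_nullVectors hw b
  have hwv : B w v = conj (B v w) := (hB v w).symm
  have h : a * conj b * B v w + b * conj a * conj (B v w) = 0 := by
    simp only [map_add, map_smul, LinearMap.add_apply, LinearMap.smul_apply,
      LinearMap.map_smulₛₗ, smul_eq_mul, hv.1, hw.1, hwv] at hab
    linear_combination hab
  obtain ⟨s, hs⟩ : ∃ s : ℝ, a * (s * I * B v w) = b := by
    have hca : conj a ≠ 0 := by simpa using ha
    have hcb : conj (B v w) ≠ 0 := by simpa using hvw
    refine ⟨(-I * b / (a * B v w)).re, ?_⟩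
    have : (((-I * b / (a * B v w)).re : ℝ) : ℂ) = -I * b / (a * B v w) := by
      rw [← conj_eq_iff_re, map_div₀, map_mul, map_mul, map_neg, conj_I]
      field_simp
      linear_combination h
    rw [this]
    field_simp
    linear_combination -b * I_sq
  have := smul_mem_nullVectors (transv_mem_nullVectors hB hv hw s) a
  rwa [transv_apply, smul_add, smul_smul, hs] at this

/-- The isotropic vector `w + u - ½ B(u, u) v` with component `u` orthogonal to the hyperbolic pair
`v, w`. -/
noncomputable def isoLift (B : V →ₗ[ℂ] V →ₗ⋆[ℂ] ℂ) (v w u : V) : V := w + u - (B u u / 2) • v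

theorem isoLift_isotropic (hB : ∀ x y, conj (B x y) = B y x) {v w u : V} (hv : B v v = 0)
    (hw : B w w = 0) (hwv : B w v = 1) (huv : B u v = 0) (huw : B u w = 0) :
    B (isoLift B v w u) (isoLift B v w u) = 0 := by
  have hvw : B v w = 1 := by rw [← hB, hwv, map_one]
  have hvu : B v u = 0 := by rw [← hB, huv, map_zero]
  have hwu : B w u = 0 := by rw [← hB, huw, map_zero]
  have h2 : (starRingEnd ℂ) 2 = 2 := Complex.conj_ofNat 2
  simp only [isoLift, map_add, map_sub, map_smul, LinearMap.add_apply, LinearMap.sub_apply,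
    LinearMap.smul_apply, LinearMap.map_smulₛₗ, smul_eq_mul, hv, hw, hvw, hwv, huv, huw, hvu, hwu,
    map_div₀, h2, hB u u]
  ring

/-- The fibres of `nullVectors` over the orthogonal components are stable under translation along
imaginary multiples of `v`, because of the transvections along `v`. -/
theorem add_smul_mem_nullVectors (hB : ∀ x y, conj (B x y) = B y x) {v w u : V}
    (hv : v ∈ nullVectors B Z) (hw : B w w = 0) (hwv : B w v = 1) (huv : B u v = 0)
    (huw : B u w = 0) {a b : ℂ} (hu : isoLift B v w u + a • v ∈ nullVectors B Z)
    (hb : conj b = -b) : isoLift B v w u + b • v ∈ nullVectors B Z := by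
  have e : B (isoLift B v w u) v = 1 := by simp [isoLift, hwv, huv, hv.1]
  have e' : B v (isoLift B v w u) = 1 := by rw [← hB, e, map_one]
  have ha : conj a = -a := by
    have h := hu.1
    simp only [map_add, map_smul, LinearMap.add_apply, LinearMap.smul_apply,
      LinearMap.map_smulₛₗ, smul_eq_mul, hv.1, e, e',
      isoLift_isotropic hB hv.1 hw hwv huv huw] at h
    linear_combination h
  have hs : (((b - a) / I).re : ℂ) = (b - a) / I := by
    rw [← conj_eq_iff_re, map_div₀, map_sub, ha, hb, conj_I]
    field_simp
    ring
  have h := transv_mem_nullVectors hB hu hv ((b - a) / I).re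
  have e2 : B (isoLift B v w u + a • v) v = 1 := by simp [e, hv.1]
  rw [transv_apply, e2, hs, mul_one, div_mul_cancel₀ _ I_ne_zero, add_assoc, ← add_smul,
    add_sub_cancel] at h
  exact h

/-- The orthogonal components of the vectors in `nullVectors` are closed under affine
combinations with coefficients that are not real. -/
theorem isoLift_affine_mem_nullVectors (hB : ∀ x y, conj (B x y) = B y x) {v w : V}
    (hv : v ∈ nullVectors B Z) (hw : B w w = 0) (hwv : B w v = 1)
    (hpos : ∀ x, B x v = 0 → B x w = 0 → B x x = 0 → x = 0) {u₁ u₂ : V}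
    (h1v : B u₁ v = 0) (h1w : B u₁ w = 0) (h2v : B u₂ v = 0) (h2w : B u₂ w = 0)
    (h1 : isoLift B v w u₁ ∈ nullVectors B Z) (h2 : isoLift B v w u₂ ∈ nullVectors B Z) {b : ℂ}
    (hb : b.im ≠ 0) : isoLift B v w ((1 - b) • u₁ + b • u₂) ∈ nullVectors B Z := by
  by_cases heq : u₁ = u₂
  · rw [heq, ← add_smul, sub_add_cancel, one_smul]
    exact h2
  have hvw : B v w = 1 := by rw [← hB, hwv, map_one]
  have hv1 : B v u₁ = 0 := by rw [← hB, h1v, map_zero]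
  have hv2 : B v u₂ = 0 := by rw [← hB, h2v, map_zero]
  have hw1 : B w u₁ = 0 := by rw [← hB, h1w, map_zero]
  have hw2 : B w u₂ = 0 := by rw [← hB, h2w, map_zero]
  have h21 : B u₂ u₁ = conj (B u₁ u₂) := (hB _ _).symm
  have h11 : conj (B u₁ u₁) = B u₁ u₁ := hB _ _
  have h22 : conj (B u₂ u₂) = B u₂ u₂ := hB _ _
  have hr : B (u₁ - u₂) (u₁ - u₂) ≠ 0 := fun h =>
    heq (sub_eq_zero.mp (hpos _ (by simp [h1v, h2v]) (by simp [h1w, h2w]) h))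
  have h2' : (starRingEnd ℂ) 2 = 2 := Complex.conj_ofNat 2
  obtain ⟨z, hz⟩ : ∃ z, z = B u₁ u₂ - B u₁ u₁ / 2 - B u₂ u₂ / 2 := ⟨_, rfl⟩
  have hzr : B (u₁ - u₂) (u₁ - u₂) = -(z + conj z) := by
    simp only [hz, map_sub, LinearMap.sub_apply, map_div₀, h2', h11, h22, h21]
    ring
  obtain ⟨p, hp⟩ : ∃ p, p = (1 - b) * conj b := ⟨_, rfl⟩
  have hpb : p - conj p = -(2 * b.im) * I := by
    apply Complex.ext <;> simp [hp]
    ring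
  -- `σ` is chosen such that the combination of `x₁` and `x₂` is isotropic
  obtain ⟨σ, hσ⟩ : ∃ σ : ℝ, p * z + conj (p * z) + 2 * σ * b.im = 0 := by
    refine ⟨-(p * z).re / b.im, ?_⟩
    have : (b.im : ℂ) ≠ 0 := by exact_mod_cast hb
    rw [add_conj]
    push_cast
    field_simp
    ring
  have hx1 : isoLift B v w u₁ + (σ * I : ℂ) • v ∈ nullVectors B Z :=
    add_smul_mem_nullVectors hB (a := 0) hv hw hwv h1v h1w (by simpa using h1) (by simp)
  have hx12 : B (isoLift B v w u₁ + (σ * I : ℂ) • v) (isoLift B v w u₂) = z + σ * I := by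
    simp only [isoLift, map_add, map_sub, map_smul, LinearMap.add_apply, LinearMap.sub_apply,
      LinearMap.smul_apply, LinearMap.map_smulₛₗ, smul_eq_mul, hv.1, hw, hvw, hwv, h1v, h1w, hv2,
      hw2, map_div₀, h2', h22, hz]
    ring
  have hne : z + σ * I ≠ 0 := fun h => hr <| by
    rw [hzr]
    have h' := congrArg conj h
    simp only [map_add, map_mul, conj_ofReal, conj_I, map_zero] at h'
    linear_combination -h - h'
  have hx21 : B (isoLift B v w u₂) (isoLift B v w u₁ + (σ * I : ℂ) • v) = conj z - σ * I := by
    rw [← hB, hx12]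
    simp only [map_add, map_mul, conj_ofReal, conj_I]
    ring
  have hmem := smul_add_smul_mem_nullVectors hB hx1 h2 (hx12 ▸ hne) (a := 1 - b) (b := b) (by
    simp only [map_add (B _), map_add B, map_smul, LinearMap.add_apply, LinearMap.smul_apply,
      LinearMap.map_smulₛₗ, smul_eq_mul] at hx12 hx21 ⊢
    have h3 := hx1.1
    simp only [map_add (B _), map_add B, map_smul, LinearMap.add_apply, LinearMap.smul_apply,
      LinearMap.map_smulₛₗ, smul_eq_mul] at h3
    have hcp : conj p = conj (1 - b) * b := by simp [hp]
    rw [map_mul] at hσ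
    linear_combination (1 - b) * conj (1 - b) * h3 + b * conj b * h2.1 + (1 - b) * conj b * hx12 +
      b * conj (1 - b) * hx21 + hσ + σ * I * hpb - 2 * σ * b.im * I_sq - (z + σ * I) * hp -
      (conj z - σ * I) * hcp)
  have := add_smul_mem_nullVectors hB (u := (1 - b) • u₁ + b • u₂) (b := 0) hv hw hwv
    (a := (1 - b) * (σ * I - B u₁ u₁ / 2) - b * (B u₂ u₂ / 2) +
      B ((1 - b) • u₁ + b • u₂) ((1 - b) • u₁ + b • u₂) / 2)
    (by simp [h1v, h2v]) (by simp [h1w, h2w]) (by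
      convert hmem using 1
      simp only [isoLift]
      module) (by simp)
  simpa using this

/-- If the isotropic vectors whose transvections belong to `Z` span the whole space of a Lorentzian
hermitian form, then they are all the isotropic vectors. -/
theorem mem_nullVectors_of_span (hB : ∀ x y, conj (B x y) = B y x)
    (hpos : ∀ x y, (B y y).re < 0 → B x y = 0 → B x x = 0 → x = 0)
    (hnd : ∀ x, (∀ y, B y x = 0) → x = 0)
    (hspan : Submodule.span ℂ (nullVectors B Z) = ⊤) {x : V} (hx : B x x = 0) :
    x ∈ nullVectors B Z := by
  by_cases hX : ∀ v ∈ nullVectors B Z, v = 0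
  · have : (x : V) ∈ (⊤ : Submodule ℂ V) := trivial
    rw [← hspan, Submodule.span_eq_bot.mpr hX, Submodule.mem_bot] at this
    refine ⟨hx, fun t => ?_⟩
    have h1 : transv B x t = 1 := by ext; simp [transv_apply, this]
    rw [h1]
    exact one_mem Z
  push Not at hX
  obtain ⟨v, hv, hv0⟩ := hX
  obtain ⟨w, hw, hwv⟩ : ∃ w ∈ nullVectors B Z, B w v = 1 := by
    by_contra! h
    refine hv0 (hnd v fun y => ?_)
    have : y ∈ Submodule.span ℂ (nullVectors B Z) := by rw [hspan]; trivial
    induction this using Submodule.span_induction with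
    | mem y hy =>
      by_contra hne
      exact h ((B y v)⁻¹ • y) (smul_mem_nullVectors hy _) (by simp [hne])
    | zero => simp
    | add y z _ _ hy hz => simp [hy, hz]
    | smul c y _ hy => simp [hy]
  have hvw : B v w = 1 := by rw [← hB, hwv, map_one]
  have hpos' : ∀ x, B x v = 0 → B x w = 0 → B x x = 0 → x = 0 := fun x hxv hxw hxx =>
    hpos x (v - w) (by simp [hv.1, hw.1, hvw, hwv]) (by simp [hxv, hxw]) hxx
  -- the orthogonal components form a complex subspace
  let U : Set V := {u | B u v = 0 ∧ B u w = 0 ∧ isoLift B v w u ∈ nullVectors B Z}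
  have hU0 : (0 : V) ∈ U := ⟨by simp, by simp, by simpa [isoLift] using hw⟩
  have haff : ∀ {u₁ u₂ : V} {b : ℂ}, u₁ ∈ U → u₂ ∈ U → b.im ≠ 0 →
      (1 - b) • u₁ + b • u₂ ∈ U := fun {u₁ u₂ b} h1 h2 hb =>
    ⟨by simp [h1.1, h2.1], by simp [h1.2.1, h2.2.1],
      isoLift_affine_mem_nullVectors hB hv hw.1 hwv hpos' h1.1 h1.2.1 h2.1 h2.2.1 h1.2.2 h2.2.2 hb⟩
  have hsmul : ∀ (c : ℂ) {u : V}, u ∈ U → c • u ∈ U := by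
    have h1 : ∀ {c : ℂ} {u : V}, c.im ≠ 0 → u ∈ U → c • u ∈ U := fun hc hu => by
      simpa using haff hU0 hu hc
    intro c u hu
    by_cases hc : c.im = 0
    · by_cases hc0 : c = 0
      · simpa [hc0] using hU0
      · -- a real scalar is a product of two scalars that are not real
        have hre : c.re ≠ 0 := fun h => hc0 (Complex.ext h hc)
        have := h1 (c := -(I * c)) (by simpa using hre) (h1 (c := I) (by simp) hu)
        rw [smul_smul] at this
        convert this using 2
        linear_combination c * I_sq
    · exact h1 hc hu
  have hadd : ∀ {u₁ u₂ : V}, u₁ ∈ U → u₂ ∈ U → u₁ + u₂ ∈ U := fun {u₁ u₂} h1 h2 => by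
    have hI : (1 - I : ℂ) ≠ 0 := fun h => by simpa using congrArg re h
    have := haff (b := I) (hsmul (1 - I)⁻¹ h1) (hsmul I⁻¹ h2) (by simp)
    rwa [smul_smul, smul_smul, mul_inv_cancel₀ hI, mul_inv_cancel₀ I_ne_zero, one_smul,
      one_smul] at this
  -- every isotropic vector not orthogonal to `v` is a multiple of some `isoLift u + c v`
  have hnorm : ∀ x, B x x = 0 → B x v = 1 → ∃ c : ℂ, conj c = -c ∧
      B (x - w - B x w • v) v = 0 ∧ B (x - w - B x w • v) w = 0 ∧
      x = isoLift B v w (x - w - B x w • v) + c • v := by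
    intro x hx hxv
    have hvx : B v x = 1 := by rw [← hB, hxv, map_one]
    have h2' : (starRingEnd ℂ) 2 = 2 := Complex.conj_ofNat 2
    refine ⟨B x w + B (x - w - B x w • v) (x - w - B x w • v) / 2, ?_, ?_, ?_, ?_⟩
    · rw [map_add, map_div₀, h2', hB (x - _ - _)]
      simp only [map_sub, map_smul, LinearMap.sub_apply, LinearMap.smul_apply,
        LinearMap.map_smulₛₗ, smul_eq_mul, hv.1, hw.1, hvw, hwv, hx, hxv, hvx, hB x w]
      ring
    · simp [hxv, hwv, hv.1]
    · simp [hw.1, hvw]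
    · simp only [isoLift]
      module
  have hcomp : ∀ y, y - B y w • v - B y v • w ∈ U := by
    intro y
    have : y ∈ Submodule.span ℂ (nullVectors B Z) := by rw [hspan]; trivial
    induction this using Submodule.span_induction with
    | mem y hy =>
      by_cases hyv : B y v = 0
      · have : y - B y w • v - B y v • w = 0 :=
          hpos' _ (by simp [hv.1, hwv]) (by simp [hw.1, hvw]) (by
            have hvy : B v y = 0 := by rw [← hB, hyv, map_zero]
            simp [hyv, hvy, hy.1, hv.1])
        rw [this]
        exact hU0
      · have hz := smul_mem_nullVectors hy (B y v)⁻¹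
        obtain ⟨c, hc, h1, h2, h3⟩ := hnorm _ hz.1 (by simp [hyv])
        rw [h3] at hz
        have h4 := add_smul_mem_nullVectors (b := 0) hB hv hw.1 hwv h1 h2 hz (by simp)
        rw [zero_smul, add_zero] at h4
        have := hsmul (B y v) (u := _) ⟨h1, h2, h4⟩
        convert this using 1
        simp only [map_smul, LinearMap.smul_apply, smul_sub, smul_smul, smul_eq_mul,
          ← mul_assoc, mul_inv_cancel₀ hyv, one_smul, one_mul]
        abel
    | zero => simpa using hU0
    | add y z _ _ hy hz =>
      convert hadd hy hz using 1
      simp only [map_add, LinearMap.add_apply]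
      module
    | smul c y _ hy =>
      convert hsmul c hy using 1
      simp only [map_smul, LinearMap.smul_apply, smul_eq_mul]
      module
  have main : ∀ x, B x x = 0 → B x v = 1 → x ∈ nullVectors B Z := by
    intro x hx hxv
    obtain ⟨c, hc, h1, h2, h3⟩ := hnorm x hx hxv
    have h4 := hcomp x
    rw [hxv, one_smul, sub_right_comm] at h4
    rw [h3]
    exact add_smul_mem_nullVectors (a := 0) hB hv hw.1 hwv h1 h2 (by simpa using h4.2.2) hc
  by_cases hxv : B x v = 0
  · have hvx : B v x = 0 := by rw [← hB, hxv, map_zero]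
    have : x - B x w • v = 0 :=
      hpos' _ (by simp [hv.1, hxv]) (by simp [hvw]) (by simp [hxv, hvx, hx, hv.1])
    rw [sub_eq_zero.mp this]
    exact smul_mem_nullVectors hv _
  · have h := smul_mem_nullVectors (main ((B x v)⁻¹ • x) (by simp [hx]) (by simp [hxv])) (B x v)
    rwa [smul_smul, mul_inv_cancel₀ hxv, one_smul] at h

end NullVectors

/-! ### Zariski closures of matrix groups -/

section ZariskiClosure

/-- A polynomial map of matrices pulls polynomials in the real coordinates back to such
polynomials. -/
theorem exists_pullback {κ : Type*} {Φ : Matrix κ κ ℂ → Matrix κ κ ℂ}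
    (h : ∀ k, ∃ c : MvPolynomial ((κ × κ) ⊕ (κ × κ)) ℝ,
      ∀ N, MvPolynomial.eval (realCoords N) c = realCoords (Φ N) k)
    (f : MvPolynomial ((κ × κ) ⊕ (κ × κ)) ℝ) :
    ∃ f' : MvPolynomial ((κ × κ) ⊕ (κ × κ)) ℝ,
      ∀ N, MvPolynomial.eval (realCoords N) f' = MvPolynomial.eval (realCoords (Φ N)) f := by
  choose c hc using h
  refine ⟨MvPolynomial.bind₁ c f, fun N => ?_⟩
  have h1 : (fun k => MvPolynomial.eval (realCoords N) (c k)) = realCoords (Φ N) :=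
    funext fun k => hc k N
  rw [← h1]
  exact MvPolynomial.eval₂Hom_bind₁ _ _ _ _

variable {ι : Type*} [Fintype ι]

theorem exists_pullback_mul_left (M : Matrix ι ι ℂ)
    (f : MvPolynomial ((ι × ι) ⊕ (ι × ι)) ℝ) :
    ∃ f' : MvPolynomial ((ι × ι) ⊕ (ι × ι)) ℝ,
      ∀ N, MvPolynomial.eval (realCoords N) f' = MvPolynomial.eval (realCoords (M * N)) f := by
  refine exists_pullback (fun k => ?_) f
  rcases k with ⟨i, j⟩ | ⟨i, j⟩
  · exact ⟨∑ k, (MvPolynomial.C (M i k).re * MvPolynomial.X (Sum.inl (k, j)) -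
      MvPolynomial.C (M i k).im * MvPolynomial.X (Sum.inr (k, j))), fun N => by
      simp [realCoords, mul_apply]⟩
  · exact ⟨∑ k, (MvPolynomial.C (M i k).re * MvPolynomial.X (Sum.inr (k, j)) +
      MvPolynomial.C (M i k).im * MvPolynomial.X (Sum.inl (k, j))), fun N => by
      simp [realCoords, mul_apply]⟩

theorem exists_pullback_mul_right (M : Matrix ι ι ℂ)
    (f : MvPolynomial ((ι × ι) ⊕ (ι × ι)) ℝ) :
    ∃ f' : MvPolynomial ((ι × ι) ⊕ (ι × ι)) ℝ,
      ∀ N, MvPolynomial.eval (realCoords N) f' = MvPolynomial.eval (realCoords (N * M)) f := by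
  refine exists_pullback (fun k => ?_) f
  rcases k with ⟨i, j⟩ | ⟨i, j⟩
  · exact ⟨∑ k, (MvPolynomial.X (Sum.inl (i, k)) * MvPolynomial.C (M k j).re -
      MvPolynomial.X (Sum.inr (i, k)) * MvPolynomial.C (M k j).im), fun N => by
      simp [realCoords, mul_apply]⟩
  · exact ⟨∑ k, (MvPolynomial.X (Sum.inl (i, k)) * MvPolynomial.C (M k j).im +
      MvPolynomial.X (Sum.inr (i, k)) * MvPolynomial.C (M k j).re), fun N => by
      simp [realCoords, mul_apply]⟩

variable [DecidableEq ι]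

/-- The Zariski closure of a group of matrices, as a monoid of endomorphisms of `ℂ^ι`. -/
def zariskiClosure (S : Subgroup (GL ι ℂ)) : Submonoid (Module.End ℂ (ι → ℂ)) where
  carrier := {g | ∀ f : MvPolynomial ((ι × ι) ⊕ (ι × ι)) ℝ,
    (∀ s ∈ S, MvPolynomial.eval (realCoords s.1) f = 0) →
      MvPolynomial.eval (realCoords (LinearMap.toMatrix' g)) f = 0}
  one_mem' f hf := by simpa using hf 1 (one_mem S)
  mul_mem' := by
    intro g h hg hh f hf
    rw [LinearMap.toMatrix'_mul]
    obtain ⟨f₁, hf₁⟩ := exists_pullback_mul_right (LinearMap.toMatrix' h) f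
    rw [← hf₁]
    refine hg f₁ fun s hs => ?_
    rw [hf₁]
    obtain ⟨f₂, hf₂⟩ := exists_pullback_mul_left s.1 f
    rw [← hf₂]
    refine hh f₂ fun r hr => ?_
    rw [hf₂]
    exact hf (s * r) (mul_mem hs hr)

theorem toLin'_mem_zariskiClosure {S : Subgroup (GL ι ℂ)} {s : GL ι ℂ} (hs : s ∈ S) :
    Matrix.toLin' s.1 ∈ zariskiClosure S := fun f hf => by
  rw [LinearMap.toMatrix'_toLin']
  exact hf s hs

/-- The Zariski closure contains the real one-parameter group of each of its transvections, as a
polynomial in one variable that vanishes on all multiples of some `c ≠ 0` is zero. -/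
theorem transv_mem_zariskiClosure {S : Subgroup (GL ι ℂ)}
    {B : (ι → ℂ) →ₗ[ℂ] (ι → ℂ) →ₗ⋆[ℂ] ℂ} {v : ι → ℂ} (hv : B v v = 0) {c : ℝ} (hc : c ≠ 0)
    (h : transv B v c ∈ zariskiClosure S) (t : ℝ) : transv B v t ∈ zariskiClosure S := by
  intro f hf
  let N := LinearMap.toMatrix' (transv B v 1 - 1)
  let q : Polynomial ℝ := MvPolynomial.aeval (fun k =>
    Polynomial.C (realCoords (1 : Matrix ι ι ℂ) k) + Polynomial.X * Polynomial.C (realCoords N k)) f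
  have hq : ∀ s : ℝ, q.eval s = MvPolynomial.eval (realCoords
      (LinearMap.toMatrix' (transv B v s))) f := by
    intro s
    have e : transv B v s = 1 + (s : ℂ) • (transv B v 1 - 1) := by
      simp [transv, smul_smul]
    have e' : realCoords (LinearMap.toMatrix' (transv B v s)) = fun k =>
        Polynomial.eval s (Polynomial.C (realCoords (1 : Matrix ι ι ℂ) k) +
          Polynomial.X * Polynomial.C (realCoords N k)) := by
      rw [e, map_add, map_smul, LinearMap.toMatrix'_one]
      funext k
      rcases k with k | k <;> simp [realCoords, N]
    rw [e', ← Polynomial.coe_evalRingHom]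
    simp only [q, MvPolynomial.aeval_def]
    rw [MvPolynomial.hom_eval₂, MvPolynomial.eval, MvPolynomial.coe_eval₂Hom]
    congr 1
    ext
    simp
  have hq0 : q = 0 := by
    refine Polynomial.eq_zero_of_infinite_isRoot q ?_
    refine Set.infinite_of_injective_forall_mem (f := fun n : ℕ => (n : ℝ) * c) (fun m n hmn => ?_)
      fun n => ?_
    · exact_mod_cast mul_right_cancel₀ hc hmn
    · have := pow_mem h n f hf
      rw [transv_pow hv] at this
      rw [Set.mem_ofPred_eq, Polynomial.IsRoot, hq, this]
  rw [← hq, hq0, Polynomial.eval_zero]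

end ZariskiClosure

/-! ### Forms of signature `(m, 1)` -/

section StandardForm

theorem stdForm_self (m n : ℕ) (x : Fin m ⊕ Fin n → ℂ) :
    stdForm m n x x =
      ((∑ i, ‖x (Sum.inl i)‖ ^ 2 - ∑ j, ‖x (Sum.inr j)‖ ^ 2 : ℝ) : ℂ) := by
  simp [stdForm, mul_conj, normSq_eq_norm_sq]

/-- In signature `(m, 1)`, an isotropic vector orthogonal to a negative one is zero. -/
theorem eq_zero_of_stdForm_eq_zero {m : ℕ} {x y : Fin m ⊕ Fin 1 → ℂ}
    (hy : (stdForm m 1 y y).re < 0) (hxy : stdForm m 1 x y = 0) (hx : stdForm m 1 x x = 0) :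
    x = 0 := by
  rw [stdForm_self, ofReal_re] at hy
  rw [stdForm_self, ofReal_eq_zero] at hx
  simp only [stdForm, Finset.univ_unique, Fin.default_eq_zero, Finset.sum_singleton] at hy hx hxy
  obtain ⟨a, ha⟩ : ∃ a, a = ‖x (Sum.inr 0)‖ := ⟨_, rfl⟩
  obtain ⟨b, hb⟩ : ∃ b, b = ‖y (Sum.inr 0)‖ := ⟨_, rfl⟩
  have hcs : (a * b) ^ 2 ≤ a ^ 2 * ∑ i, ‖y (Sum.inl i)‖ ^ 2 := by
    have h1 : a * b ≤ ∑ i, ‖x (Sum.inl i)‖ * ‖y (Sum.inl i)‖ := by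
      calc a * b = ‖∑ i, x (Sum.inl i) * conj (y (Sum.inl i))‖ := by
            rw [sub_eq_zero.mp hxy, norm_mul, RCLike.norm_conj, ha, hb]
        _ ≤ _ := (norm_sum_le _ _).trans_eq (by simp)
    have hab : 0 ≤ a * b := by rw [ha, hb]; positivity
    calc (a * b) ^ 2 ≤ (∑ i, ‖x (Sum.inl i)‖ * ‖y (Sum.inl i)‖) ^ 2 := by gcongr
      _ ≤ _ := Finset.sum_mul_sq_le_sq_mul_sq _ _ _
      _ = _ := by rw [sub_eq_zero.mp hx, ha]
  have ha0 : a = 0 := by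
    by_contra h
    have : 0 < a ^ 2 := by positivity
    rw [← hb] at hy
    nlinarith
  have hsum : ∑ i, ‖x (Sum.inl i)‖ ^ 2 = 0 := by
    rw [sub_eq_zero.mp hx, ← ha, ha0]
    simp
  funext i
  rcases i with i | i
  · have := (Finset.sum_eq_zero_iff_of_nonneg (fun i _ => by positivity)).mp hsum i
      (Finset.mem_univ _)
    simpa using this
  · rw [Subsingleton.elim i 0]
    simpa [ha0] using ha.symm

/-- An orthogonal family of vectors of norms `1` and `-1` identifies a form with the standard
one. -/
theorem exists_equiv_stdForm {κ : Type*} [Fintype κ] {B : (κ → ℂ) →ₗ[ℂ] (κ → ℂ) →ₗ⋆[ℂ] ℂ}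
    {m n : ℕ} (hcard : Fintype.card κ = m + n) (b : Fin m ⊕ Fin n → κ → ℂ)
    (hb : ∀ i j, B (b i) (b j) = if i = j then Sum.elim (fun _ => 1) (fun _ => -1) i else 0) :
    ∃ φ : (κ → ℂ) ≃ₗ[ℂ] (Fin m ⊕ Fin n → ℂ), ∀ x y, B x y = stdForm m n (φ x) (φ y) := by
  let ψ : (Fin m ⊕ Fin n → ℂ) →ₗ[ℂ] (κ → ℂ) := Fintype.linearCombination ℂ b
  have hψ : ∀ x y, B (ψ x) (ψ y) = stdForm m n x y := by
    intro x y
    simp only [ψ, Fintype.linearCombination_apply, map_sum, map_smul, LinearMap.map_smulₛₗ,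
      LinearMap.sum_apply, LinearMap.smul_apply, hb, stdForm]
    simp [Fintype.sum_sum_type, mul_comm, sub_eq_add_neg]
  have hinj : Function.Injective ψ := by
    rw [← LinearMap.ker_eq_bot, LinearMap.ker_eq_bot']
    intro x hx
    have h : ∀ y, stdForm m n x y = 0 := fun y => by rw [← hψ, hx]; simp
    funext i
    have := h (Pi.single i 1)
    rcases i with i | i <;> simpa [stdForm, Pi.single_apply] using this
  let φ := LinearEquiv.ofInjectiveOfFinrankEq ψ hinj (by simp [hcard])
  refine ⟨φ.symm, fun x y => ?_⟩
  have hφ : ∀ z, ψ (φ.symm z) = z := fun z => φ.apply_symm_apply z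
  rw [← hψ, hφ, hφ]

variable {ι : Type*} [Fintype ι] [DecidableEq ι]

variable {B : (ι → ℂ) →ₗ[ℂ] (ι → ℂ) →ₗ⋆[ℂ] ℂ}

/-- A group `S` of isometries of determinant one is Zariski dense in the special unitary group of a
form of signature `(m, 1)` if the isotropic vectors with transvections in the Zariski closure
of `S` span the whole space. -/
theorem isZariskiDenseIn_of_span {m : ℕ} (hm : 1 ≤ m) {S : Subgroup (GL ι ℂ)}
    (φ : (ι → ℂ) ≃ₗ[ℂ] (Fin m ⊕ Fin 1 → ℂ)) (hφ : ∀ x y, B x y = stdForm m 1 (φ x) (φ y))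
    (hS : S ≤ SU fun x y => B x y)
    (hspan : Submodule.span ℂ (nullVectors B (zariskiClosure S)) = ⊤) :
    IsZariskiDenseIn (S : Set (GL ι ℂ)) (SU fun x y => B x y) := by
  refine ⟨hS, fun f hf g hg => ?_⟩
  obtain ⟨k, rfl⟩ : ∃ k, m = k + 1 := ⟨m - 1, by omega⟩
  have hB : ∀ x y, conj (B x y) = B y x := fun x y => by
    simp [hφ, stdForm, mul_comm]
  have hpos : ∀ x y, (B y y).re < 0 → B x y = 0 → B x x = 0 → x = 0 := fun x y h1 h2 h3 => by
    rw [hφ] at h1 h2 h3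
    simpa using eq_zero_of_stdForm_eq_zero h1 h2 h3
  have hnull : ∀ v, B v v = 0 → v ∈ nullVectors B (zariskiClosure S) := fun v hv => by
    refine mem_nullVectors_of_span hB hpos (fun x hx => ?_) hspan hv
    refine hpos x (φ.symm (Pi.single (Sum.inr 0) 1)) ?_ ?_ (hx x)
    · simp [hφ, stdForm]
    · rw [← hB, hx, map_zero]
  have hle : transvMonoid B ≤ zariskiClosure S := by
    rw [transvMonoid, Submonoid.closure_le]
    rintro _ ⟨v, t, hv, rfl⟩
    exact (hnull v hv).2 t
  let b : Fin (k + 1) ⊕ Fin 1 → ι → ℂ := fun i => φ.symm (Pi.single i 1)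
  have hb : ∀ i j, B (b i) (b j) = if i = j then Sum.elim (fun _ => 1) (fun _ => -1) i else 0 := by
    intro i j
    rcases i with i | i <;> rcases j with j | j <;>
      simp [b, hφ, stdForm, Pi.single_apply, Fin.fin_one_eq_zero, eq_comm]
  have hφb : ∀ x, x = ∑ i, φ x i • b i := fun x => by
    apply φ.injective
    simp only [map_sum, map_smul, b, LinearEquiv.apply_symm_apply]
    exact pi_eq_sum_univ' _
  have hbx : ∀ x i, B x (b i) = Sum.elim (fun _ => 1) (fun _ => -1) i * φ x i := fun x i => by
    rcases i with i | i <;> simp [b, hφ, stdForm, Pi.single_apply, Fin.fin_one_eq_zero]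
  have hmem : Matrix.toLin' g.1 ∈ transvMonoid B := by
    refine mem_transvMonoid_of_det_eq_one hB (v := b (Sum.inl (Fin.last k)) + b (Sum.inr 0))
      (w := (1 / 2 : ℂ) • (b (Sum.inl (Fin.last k)) - b (Sum.inr 0)))
      ?_ ?_ ?_ (fun i : Fin k => b (Sum.inl i.castSucc)) ?_ ?_ ?_ ?_ ?_ ?_ ?_
    · simp [hb]
    · simp [hb]
    · simp [hb]
      rw [Complex.conj_ofNat]
      norm_num
    · intro i; simp [hb, Fin.castSucc_ne_last]
    · intro i; simp [hb, Fin.castSucc_ne_last]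
    · intro i; simp [hb]
    · intro i j hij; simp [hb, hij]
    · intro x
      have h2' : (starRingEnd ℂ) 2 = 2 := Complex.conj_ofNat 2
      conv_lhs => rw [hφb x]
      simp only [Fintype.sum_sum_type, Fin.sum_univ_castSucc, Finset.univ_unique,
        Fin.default_eq_zero, Finset.sum_singleton, map_add, map_sub, LinearMap.map_smulₛₗ, hbx,
        Sum.elim_inl, Sum.elim_inr, one_mul, smul_eq_mul, map_div₀, h2', map_one]
      module
    · intro x y; exact hg.1 x y
    · rw [LinearMap.det_toLin']; exact hg.2
  have := hle hmem f hf
  rwa [LinearMap.toMatrix'_toLin'] at this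

/-- Conjugation by an isomorphism of forms identifies their special unitary groups. -/
theorem isStandardSU_of_equiv {F : (ι → ℂ) → (ι → ℂ) → ℂ} {m n : ℕ}
    (φ : (ι → ℂ) ≃ₗ[ℂ] (Fin m ⊕ Fin n → ℂ)) (hφ : ∀ x y, F x y = stdForm m n (φ x) (φ y)) :
    IsStandardSU F m n := by
  let Θ : GL ι ℂ ≃* GL (Fin m ⊕ Fin n) ℂ := GeneralLinearGroup.toLin.trans
    ((LinearMap.GeneralLinearGroup.congrLinearEquiv φ).trans GeneralLinearGroup.toLin.symm)
  have hΘ : ∀ (g : GL ι ℂ) x, φ (g.1 *ᵥ x) = (Θ g).1 *ᵥ φ x := by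
    intro g x
    have h : GeneralLinearGroup.toLin (Θ g) =
        LinearMap.GeneralLinearGroup.congrLinearEquiv φ (GeneralLinearGroup.toLin g) := by
      simp [Θ]
    have h1 : (Θ g).1 *ᵥ φ x =
        (LinearMap.GeneralLinearGroup.congrLinearEquiv φ (GeneralLinearGroup.toLin g)).1 (φ x) := by
      rw [← h]; rfl
    rw [h1]
    have h2 : (LinearMap.GeneralLinearGroup.congrLinearEquiv φ
        (GeneralLinearGroup.toLin g)).1 (φ x) =
        φ ((GeneralLinearGroup.toLin g).1 (φ.symm (φ x))) := rfl
    rw [h2, φ.symm_apply_apply]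
    rfl
  have hdet : ∀ g : GL ι ℂ, (Θ g).1.det = g.1.det := by
    intro g
    rw [← LinearMap.det_toLin', ← LinearMap.det_toLin' g.1, ← LinearMap.det_conj _ φ]
    congr 1
    refine LinearMap.ext fun y => ?_
    obtain ⟨x, rfl⟩ := φ.surjective y
    simp [hΘ]
  have hmem : ∀ g : GL ι ℂ, g ∈ SU F ↔ Θ g ∈ SU (stdForm m n) := by
    intro g
    refine and_congr ⟨fun h x y => ?_, fun h x y => ?_⟩ (by rw [hdet])
    · obtain ⟨x, rfl⟩ := φ.surjective x
      obtain ⟨y, rfl⟩ := φ.surjective y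
      rw [← hΘ, ← hΘ, ← hφ, ← hφ, h]
    · rw [hφ, hφ, hΘ, hΘ, h]
  have hmap : (SU F).map Θ.toMonoidHom = SU (stdForm m n) := by
    ext g
    rw [Subgroup.mem_map]
    constructor
    · rintro ⟨h, hh, rfl⟩
      exact (hmem h).mp hh
    · intro hg
      exact ⟨Θ.symm g, (hmem _).mpr (by simpa using hg), by simp⟩
  exact ⟨φ, hφ, (Θ.subgroupMap (SU F)).trans (MulEquiv.subgroupCongr hmap), fun g x => hΘ g.1 x⟩

end StandardForm

/-! ### The reflections `L_p` and their product -/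

section Coxeter

/-- The form `Q_α` as a sesquilinear map. -/
noncomputable def formQ (α : ℝ) (d : ℕ) : (A d → ℂ) →ₗ[ℂ] (A d → ℂ) →ₗ⋆[ℂ] ℂ :=
  LinearMap.mk₂'ₛₗ (RingHom.id ℂ) (starRingEnd ℂ) (Q α d)
    (fun x x' y => by simp [Q, add_mul, Finset.sum_add_distrib])
    (fun c x y => by simp [Q, Finset.mul_sum, mul_assoc])
    (fun x y y' => by simp [Q, mul_add, add_mul, Finset.sum_add_distrib])
    (fun c x y => by simp [Q, Finset.mul_sum, mul_assoc, mul_left_comm])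

@[simp]
theorem formQ_apply (α : ℝ) (d : ℕ) (x y : A d → ℂ) : formQ α d x y = Q α d x y := rfl

theorem formQ_conj (α : ℝ) (d : ℕ) (x y : A d → ℂ) :
    conj (formQ α d x y) = formQ α d y x := by
  have h : ∀ p q : A d, conj (gram α p q) = gram α q p := by
    intro p q
    rcases lt_trichotomy p q with h | h | h
    · simp [gram, h, h.ne, h.ne', h.not_gt]
    · simp [gram, h]
    · simp [gram, h, h.ne, h.ne', h.not_gt]
  simp only [formQ_apply, Q, map_sum, map_mul, h, conj_conj]
  rw [Finset.sum_comm]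
  exact Finset.sum_congr rfl fun p _ => Finset.sum_congr rfl fun q _ => by ring

theorem conj_rho (α : ℝ) : conj (rho α) = zeta α := by
  rw [zeta, rho, ← Complex.exp_conj, ← Complex.exp_neg]
  simp [Complex.conj_ofNat]

theorem conj_zeta (α : ℝ) : conj (zeta α) = rho α := by
  rw [← conj_rho, conj_conj]

theorem one_add_zeta_ne_zero {α : ℝ} (h : (rho α).im ≠ 0) : 1 + zeta α ≠ 0 := by
  intro h'
  apply h
  have := congrArg im h'
  simpa [← conj_rho] using this

/-- The linear form `ℓ_p` with `L_p x = x - ℓ_p(x) e_p`. -/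
noncomputable def ell (α : ℝ) {d : ℕ} (p : A d) (x : A d → ℂ) : ℂ :=
  ∑ q, (if p < q then 1 else if q < p then zeta α else 1 + zeta α) * x q

theorem L_mulVec (α : ℝ) {d : ℕ} (p : A d) (x : A d → ℂ) :
    (L α p).1 *ᵥ x = x - ell α p x • e p := by
  funext r
  change (Lmat α p *ᵥ x) r = _
  rw [Lmat_eq]
  simp only [mulVec, dotProduct, of_apply, sub_mul, Finset.sum_sub_distrib, ell, Pi.sub_apply,
    Pi.smul_apply, smul_eq_mul, Finset.sum_mul]
  congr 1
  · simp [e, Pi.single_apply]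
  · exact Finset.sum_congr rfl fun q _ => by ring

/-- `L_p` is a complex reflection for the form `Q_α`. -/
theorem ell_eq {α : ℝ} (h : 1 + zeta α ≠ 0) {d : ℕ} (p : A d) (x : A d → ℂ) :
    ell α p x = (1 + zeta α) * formQ α d x (e p) := by
  have hz := zeta_mul_rho α
  have h' : 1 + rho α ≠ 0 := fun h0 => h (by linear_combination zeta α * h0 - hz)
  simp only [formQ_apply, Q, e, Pi.single_apply, ell, Finset.mul_sum]
  refine Finset.sum_congr rfl fun q _ => ?_
  rw [Finset.sum_eq_single p (fun r _ hr => by simp [hr]) (by simp)]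
  rcases lt_trichotomy p q with hpq | hpq | hpq
  · simp [gram, hpq, hpq.ne']
    field_simp
  · simp [gram, hpq]
  · simp [gram, hpq, hpq.ne, hpq.not_gt, conj_zeta]
    field_simp
    linear_combination x q * hz

theorem formQ_L {α : ℝ} (h : 1 + zeta α ≠ 0) {d : ℕ} (p : A d) (x y : A d → ℂ) :
    formQ α d ((L α p).1 *ᵥ x) ((L α p).1 *ᵥ y) = formQ α d x y := by
  have hz := zeta_mul_rho α
  have h1 : formQ α d (e p) (e p) = 1 := by
    simp only [formQ_apply, Q, e]
    rw [Finset.sum_eq_single p (fun r _ hr => by simp [hr]) (by simp),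
      Finset.sum_eq_single p (fun r _ hr => by simp [hr]) (by simp)]
    simp [gram]
  rw [L_mulVec, L_mulVec, ell_eq h, ell_eq h]
  simp only [map_sub, map_smul, LinearMap.sub_apply, LinearMap.smul_apply, LinearMap.map_smulₛₗ,
    smul_eq_mul, h1, map_mul, formQ_conj, map_add, map_one, conj_zeta]
  linear_combination formQ α d x (e p) * formQ α d (e p) y * hz

theorem formQ_Gam {α : ℝ} (h : 1 + zeta α ≠ 0) {d : ℕ} {g : GL (A d) ℂ} (hg : g ∈ Gam α d)
    (x y : A d → ℂ) : formQ α d (g.1 *ᵥ x) (g.1 *ᵥ y) = formQ α d x y := by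
  induction hg using Subgroup.closure_induction generalizing x y with
  | mem g hg => obtain ⟨p, rfl⟩ := hg; exact formQ_L h p x y
  | one => simp
  | mul g k _ _ hg hk =>
    rw [Units.val_mul, ← mulVec_mulVec, ← mulVec_mulVec, hg, hk]
  | inv g _ hg =>
    rw [← hg, mulVec_mulVec, mulVec_mulVec, Units.mul_inv, one_mulVec, one_mulVec]

/-- The increasing enumeration of `𝒜_d` for `d = m + 1`. -/
def pt (m : ℕ) (j : Fin (m + 1)) : A (m + 1) :=
  ⟨2 * (j.1 : ℤ) + 1 - ((m + 1 : ℕ) : ℤ),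
    Finset.mem_image.mpr ⟨j.1, Finset.mem_range.mpr j.2, rfl⟩⟩

theorem pt_lt_pt {m : ℕ} {i j : Fin (m + 1)} : pt m i < pt m j ↔ i < j := by
  rw [← Subtype.coe_lt_coe, Fin.lt_def]
  simp only [pt]
  omega

theorem pt_bijective (m : ℕ) : Function.Bijective (pt m) := by
  constructor
  · intro i j h
    have := congrArg Subtype.val h
    simp only [pt] at this
    exact Fin.ext (by omega)
  · rintro ⟨p, hp⟩
    obtain ⟨j, hj, rfl⟩ := Finset.mem_image.mp hp
    exact ⟨⟨j, Finset.mem_range.mp hj⟩, rfl⟩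

/-- The coordinates of a vector, numbered by `0, …, m` and extended by zero. -/
def coord {m : ℕ} (x : A (m + 1) → ℂ) (n : ℕ) : ℂ := if h : n < m + 1 then x (pt m ⟨n, h⟩) else 0

theorem coord_ext {m : ℕ} {x y : A (m + 1) → ℂ} (h : ∀ n ≤ m, coord x n = coord y n) : x = y := by
  funext p
  obtain ⟨⟨j, hj⟩, rfl⟩ := (pt_bijective m).2 p
  simpa [coord, hj] using h j (Nat.lt_succ_iff.mp hj)

theorem sum_eq_sum_range {m : ℕ} (F : A (m + 1) → ℂ) (G : ℕ → ℂ)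
    (h : ∀ j (hj : j < m + 1), F (pt m ⟨j, hj⟩) = G j) :
    ∑ q, F q = ∑ j ∈ Finset.range (m + 1), G j := by
  rw [← (pt_bijective m).sum_comp, Finset.sum_range]
  exact Finset.sum_congr rfl fun j _ => h j.1 j.2

theorem ell_pt (α : ℝ) {m k : ℕ} (hk : k < m + 1) (x : A (m + 1) → ℂ) :
    ell α (pt m ⟨k, hk⟩) x = ∑ j ∈ Finset.range (m + 1), coord x j -
      ∑ j ∈ Finset.range k, coord x j + zeta α * ∑ j ∈ Finset.range (k + 1), coord x j := by
  have h1 : ell α (pt m ⟨k, hk⟩) x = ∑ j ∈ Finset.range (m + 1), (coord x j -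
      (if j ∈ Finset.range k then coord x j else 0) +
      zeta α * if j ∈ Finset.range (k + 1) then coord x j else 0) := by
    refine sum_eq_sum_range _ _ fun j hj => ?_
    have hc : coord x j = x (pt m ⟨j, hj⟩) := dif_pos hj
    simp only [pt_lt_pt, Fin.mk_lt_mk, Finset.mem_range, hc]
    rcases lt_trichotomy k j with h | h | h
    · simp [h, h.not_gt]
    · subst h
      simp
      ring
    · simp [h, h.not_gt, Nat.lt_succ_of_lt h]
  rw [h1, Finset.sum_add_distrib, Finset.sum_sub_distrib, ← Finset.mul_sum, Finset.sum_ite_mem,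
    Finset.sum_ite_mem, Finset.inter_eq_right.mpr (Finset.range_mono hk),
    Finset.inter_eq_right.mpr (Finset.range_mono hk.le)]

theorem coord_sub {m : ℕ} (x y : A (m + 1) → ℂ) (n : ℕ) :
    coord (x - y) n = coord x n - coord y n := by
  unfold coord; split_ifs <;> simp

theorem coord_add {m : ℕ} (x y : A (m + 1) → ℂ) (n : ℕ) :
    coord (x + y) n = coord x n + coord y n := by
  unfold coord; split_ifs <;> simp

theorem coord_smul {m : ℕ} (c : ℂ) (x : A (m + 1) → ℂ) (n : ℕ) :
    coord (c • x) n = c * coord x n := by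
  unfold coord; split_ifs <;> simp

theorem coord_e {m k : ℕ} (hk : k < m + 1) (n : ℕ) :
    coord (e (pt m ⟨k, hk⟩)) n = if n = k then 1 else 0 := by
  unfold coord
  by_cases hn : n < m + 1
  · simp [hn, e, Pi.single_apply, (pt_bijective m).1.eq_iff]
  · rw [dif_neg hn, if_neg (by omega)]

theorem coord_L (α : ℝ) {m k : ℕ} (hk : k < m + 1) (x : A (m + 1) → ℂ) (n : ℕ) :
    coord ((L α (pt m ⟨k, hk⟩)).1 *ᵥ x) n = if n = k then
      ∑ j ∈ Finset.range (k + 1), coord x j - ∑ j ∈ Finset.range (m + 1), coord x j -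
        zeta α * ∑ j ∈ Finset.range (k + 1), coord x j else coord x n := by
  rw [L_mulVec, coord_sub, coord_smul, coord_e, ell_pt]
  split_ifs with h
  · rw [h, Finset.sum_range_succ _ k]
    ring
  · simp

/-- The product `L_0 L_1 ⋯ L_{k-1}` in the numbering of `𝒜_d` by `0, …, m`, for `k ≤ m + 1`. Larger
indices are reduced modulo `m + 1`. -/
noncomputable def prodL (α : ℝ) (m : ℕ) : ℕ → GL (A (m + 1)) ℂ
  | 0 => 1
  | k + 1 => prodL α m k * L α (pt m (Fin.ofNat (m + 1) k))

theorem prodL_mem_Gam (α : ℝ) (m k : ℕ) : prodL α m k ∈ Gam α (m + 1) := by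
  induction k with
  | zero => exact one_mem _
  | succ k ih => exact mul_mem ih (Subgroup.subset_closure ⟨_, rfl⟩)

/-- The product of the first `k` reflections maps the coordinates `x_0, …, x_{k-1}`
to `ζ x_1, …, ζ x_{k-1}, y`, with `y` as in the second case below, and fixes the other ones. -/
theorem coord_prodL (α : ℝ) (m k : ℕ) (hk : k ≤ m + 1) (x : A (m + 1) → ℂ) (n : ℕ) :
    coord ((prodL α m k).1 *ᵥ x) n =
      if n + 1 < k then zeta α * coord x (n + 1)
      else if n + 1 = k then ∑ j ∈ Finset.range k, coord x j -
        ∑ j ∈ Finset.range (m + 1), coord x j - zeta α * ∑ j ∈ Finset.range k, coord x j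
      else coord x n := by
  induction k generalizing x n with
  | zero => simp [prodL]
  | succ k ih =>
    have hk' : k < m + 1 := hk
    have hpt : Fin.ofNat (m + 1) k = ⟨k, hk'⟩ := Fin.ext (Nat.mod_eq_of_lt hk')
    have hL := coord_L α hk' x
    rw [prodL, Units.val_mul, ← mulVec_mulVec, hpt, ih (by omega)]
    rcases lt_trichotomy (n + 1) k with h | h | h
    · rw [if_pos h, if_pos (by omega), hL, if_neg (by omega)]
    · have h1 : ∑ j ∈ Finset.range k, coord ((L α (pt m ⟨k, hk'⟩)).1 *ᵥ x) j =
          ∑ j ∈ Finset.range k, coord x j :=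
        Finset.sum_congr rfl fun j hj => by
          rw [hL, if_neg (Finset.mem_range.mp hj).ne]
      have h2 : ∑ j ∈ Finset.range (m + 1), coord ((L α (pt m ⟨k, hk'⟩)).1 *ᵥ x) j =
          ∑ j ∈ Finset.range (m + 1), coord x j - ell α (pt m ⟨k, hk'⟩) x := by
        simp only [L_mulVec, coord_sub, coord_smul, coord_e, Finset.sum_sub_distrib,
          ← Finset.mul_sum]
        simp [hk']
      rw [if_neg (by omega), if_pos h, if_pos (by omega), h1, h2, h, ell_pt,
        Finset.sum_range_succ _ k]
      ring
    · rw [if_neg (by omega), if_neg (by omega), if_neg (by omega), hL]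
      by_cases hn : n = k
      · rw [if_pos hn, if_pos (by omega)]
      · rw [if_neg hn, if_neg (by omega)]

/-- The vector with coordinates `F 0, …, F m`: the element `p` of `𝒜_d`
has the number `(p + m) / 2`. -/
def ofCoord (m : ℕ) (F : ℕ → ℂ) : A (m + 1) → ℂ := fun p => F ((p.1 + m) / 2).toNat

theorem coord_ofCoord {m n : ℕ} (F : ℕ → ℂ) (hn : n ≤ m) : coord (ofCoord m F) n = F n := by
  rw [coord, dif_pos (Nat.lt_succ_of_le hn), ofCoord]
  congr 1
  simp only [pt]
  omega

/-- The vector `(1, ρ, …, ρ^{m-1}, 0)`, which is isotropic when `ρ^d = 1`. -/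
noncomputable def nullVec (α : ℝ) (m : ℕ) : A (m + 1) → ℂ :=
  ofCoord m fun n => if n < m then rho α ^ n else 0

theorem coord_nullVec (α : ℝ) {m n : ℕ} (hn : n ≤ m) :
    coord (nullVec α m) n = if n < m then rho α ^ n else 0 :=
  coord_ofCoord _ hn

/-- When `ρ^d = 1`, the `d`-th power of the product of all reflections but the last one is a
transvection: up to `ζ`, the product is a cyclic shift of the `d` numbers `x_0, …, x_{m-1}` and
`-(x_0 + ⋯ + x_{m-1}) - ρ x_m`, except for an increment of the last one that is proportional
to `x_m`. -/
theorem coord_prodL_pow {α : ℝ} {m : ℕ} (hd : rho α ^ (m + 1) = 1) (x : A (m + 1) → ℂ) {n : ℕ}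
    (hn : n ≤ m) : coord ((prodL α m m ^ (m + 1)).1 *ᵥ x) n =
      coord x n + rho α * (1 - rho α) * coord x m * coord (nullVec α m) n := by
  have hz := zeta_mul_rho α
  have hzpow : ∀ t, zeta α ^ t * rho α ^ t = 1 := fun t => by rw [← mul_pow, hz, one_pow]
  have hC := coord_prodL α m m (Nat.le_succ m)
  obtain ⟨s, hs⟩ : ∃ s, s = coord x m := ⟨_, rfl⟩
  -- the sequence `z` is the cyclic extension of the `d` numbers, with the increments
  let z₀ : ℕ → ℂ := fun n => if n < m then coord x n else
    -∑ j ∈ Finset.range m, coord x j - rho α * s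
  let z : ℕ → ℂ := fun n => if n < m + 1 then z₀ n else
    z₀ (n - (m + 1)) + rho α ^ (n - (m + 1) + 1) * (1 - rho α) * s
  have hz1 : ∀ n < m, z n = coord x n := fun n hn => by
    simp only [z, z₀, if_pos hn, if_pos (Nat.lt_succ_of_lt hn)]
  have hz2 : ∀ n < m + 1, z (n + (m + 1)) = z n + rho α ^ (n + 1) * (1 - rho α) * s :=
    fun n hn => by
      simp only [z, if_pos hn, if_neg (show ¬n + (m + 1) < m + 1 by omega), Nat.add_sub_cancel]
  have hzm : z m = -∑ j ∈ Finset.range m, coord x j - rho α * s := by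
    simp only [z, z₀, if_pos (Nat.lt_succ_self m), if_neg (lt_irrefl m)]
  -- `coord (C ^ t x) n` is `ζ ^ t z (n + t)` for the product `C`, because the sums of `z` over
  -- windows of length `d` are known
  have hwin : ∀ t ≤ m + 1, ∑ j ∈ Finset.range (m + 1), z (j + t) = -rho α ^ (t + 1) * s := by
    intro t
    induction t with
    | zero =>
      intro _
      rw [Finset.sum_range_succ, Finset.sum_congr rfl fun j hj =>
        hz1 (j + 0) (Finset.mem_range.mp hj), add_zero, hzm]
      simp only [add_zero]
      ring
    | succ t ih =>
      intro ht
      have h1 := ih (by omega)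
      have h2 := Finset.sum_range_succ' (fun j => z (j + t)) (m + 1)
      rw [Finset.sum_range_succ, h1, zero_add] at h2
      have h3 := hz2 t ht
      have h4 : ∑ j ∈ Finset.range (m + 1), z (j + (t + 1)) =
          ∑ j ∈ Finset.range (m + 1), z (j + 1 + t) :=
        Finset.sum_congr rfl fun j _ => by rw [add_assoc, add_comm 1 t]
      rw [h4]
      rw [add_comm (m + 1) t, h3] at h2
      linear_combination -h2
  have hiter : ∀ t ≤ m + 1, (∀ n < m, coord ((prodL α m m ^ t).1 *ᵥ x) n =
      zeta α ^ t * z (n + t)) ∧ coord ((prodL α m m ^ t).1 *ᵥ x) m = s := by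
    intro t
    induction t with
    | zero => exact fun _ => ⟨fun n hn => by simp [hz1 n hn], by simp [hs]⟩
    | succ t ih =>
      intro ht
      obtain ⟨ih1, ih2⟩ := ih (by omega)
      rw [pow_succ', Units.val_mul, ← mulVec_mulVec]
      refine ⟨fun n hn => ?_, ?_⟩
      · rw [hC]
        by_cases hn' : n + 1 < m
        · rw [if_pos hn', ih1 _ hn', add_assoc, add_comm 1 t, pow_succ]
          ring
        · have hnm : n + 1 = m := by omega
          rw [if_neg hn', if_pos hnm, Finset.sum_range_succ _ m, ih2,
            Finset.sum_congr rfl fun j hj => ih1 j (Finset.mem_range.mp hj), ← Finset.mul_sum]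
          have h1 := hwin t (by omega)
          rw [Finset.sum_range_succ] at h1
          have h2 : n + (t + 1) = m + t := by omega
          rw [h2]
          have h3 := hzpow (t + 1)
          linear_combination -zeta α ^ (t + 1) * h1 + s * h3
      · rw [hC, if_neg (by omega), if_neg (by omega), ih2]
  have hzd : zeta α ^ (m + 1) = 1 := by rw [zeta, inv_pow, hd, inv_one]
  obtain ⟨h1, h2⟩ := hiter (m + 1) le_rfl
  rw [coord_nullVec α hn]
  split_ifs with hnm
  · rw [h1 n hnm, hzd, hz2 n (by omega), hz1 n hnm, hs]
    ring
  · have : n = m := by omega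
    rw [this, h2, hs]
    ring

theorem ell_nullVec {α : ℝ} {m : ℕ} (hd : rho α ^ (m + 1) = 1) (hρ : rho α ≠ 1) {k : ℕ}
    (hk : k < m + 1) :
    ell α (pt m ⟨k, hk⟩) (nullVec α m) = if k = m then -zeta α ^ 2 else 0 := by
  have hz := zeta_mul_rho α
  have hsum : ∑ j ∈ Finset.range (m + 1), rho α ^ j = 0 := by
    have := geom_sum_mul (rho α) (m + 1)
    rw [hd, sub_self] at this
    exact (mul_eq_zero.mp this).resolve_right (sub_ne_zero.mpr hρ)
  have hpow : rho α ^ m = zeta α := by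
    rw [pow_succ] at hd
    linear_combination zeta α * hd - rho α ^ m * hz
  rw [Finset.sum_range_succ, hpow] at hsum
  have hS : ∀ k ≤ m, ∑ j ∈ Finset.range k, coord (nullVec α m) j =
      ∑ j ∈ Finset.range k, rho α ^ j := fun k hk =>
    Finset.sum_congr rfl fun j hj => by
      have hj := (Finset.mem_range.mp hj).trans_le hk
      rw [coord_nullVec α hj.le, if_pos hj]
  have hm : coord (nullVec α m) m = 0 := by rw [coord_nullVec α le_rfl, if_neg (lt_irrefl _)]
  rw [ell_pt, Finset.sum_range_succ _ m, hm]
  split_ifs with h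
  · subst h
    rw [Finset.sum_range_succ, hm, hS k le_rfl]
    linear_combination zeta α * hsum
  · have hkm : k + 1 ≤ m := by omega
    rw [hS _ hkm, hS _ le_rfl, hS k (by omega), Finset.sum_range_succ' _ k, mul_add,
      Finset.mul_sum]
    have : ∀ j ∈ Finset.range k, zeta α * rho α ^ (j + 1) = rho α ^ j := fun j _ => by
      rw [pow_succ]
      linear_combination rho α ^ j * hz
    rw [Finset.sum_congr rfl this]
    linear_combination hsum

theorem formQ_eq_sum (α : ℝ) {m : ℕ} (x y : A (m + 1) → ℂ) (G : ℕ → ℂ)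
    (h : ∀ j (hj : j < m + 1), formQ α (m + 1) x (e (pt m ⟨j, hj⟩)) = G j) :
    formQ α (m + 1) x y = ∑ j ∈ Finset.range (m + 1), conj (coord y j) * G j := by
  have hy : y = ∑ p, y p • (e p : A (m + 1) → ℂ) := pi_eq_sum_univ' y
  conv_lhs => rw [hy]
  rw [map_sum]
  refine sum_eq_sum_range _ _ fun j hj => ?_
  rw [LinearMap.map_smulₛₗ, smul_eq_mul, h, coord, dif_pos hj]

end Coxeter

/-! ### The signature of `Q_α` -/

section Signature

/-- The Gram matrix of `Q_α` is a twisted circulant matrix, so the geometric progressions with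
ratio `μ`, `μ^d = ζ`, are eigenvectors. -/
theorem formQ_geom {α : ℝ} (h : 1 + zeta α ≠ 0) {m : ℕ} {μ ν : ℂ} (hμ : μ ^ (m + 1) = zeta α)
    (hμ1 : μ ≠ 1) :
    formQ α (m + 1) (ofCoord m (μ ^ ·)) (ofCoord m (ν ^ ·)) =
      (zeta α * μ - 1) / ((μ - 1) * (1 + zeta α)) *
        ∑ j ∈ Finset.range (m + 1), (μ * conj ν) ^ j := by
  have h1 : μ - 1 ≠ 0 := sub_ne_zero.mpr hμ1
  rw [formQ_eq_sum α _ _ fun j => (zeta α * μ - 1) / ((μ - 1) * (1 + zeta α)) * μ ^ j,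
    Finset.mul_sum]
  · refine Finset.sum_congr rfl fun j hj => ?_
    rw [coord_ofCoord _ (Nat.lt_succ_iff.mp (Finset.mem_range.mp hj)), map_pow, mul_pow]
    ring
  · intro k hk
    have hS : ∀ n ≤ m + 1, ∑ j ∈ Finset.range n, coord (ofCoord m (μ ^ ·)) j =
        (μ ^ n - 1) / (μ - 1) := fun n hn => by
      rw [← geom_sum_eq hμ1]
      exact Finset.sum_congr rfl fun j hj =>
        coord_ofCoord _ (by have := Finset.mem_range.mp hj; omega)
    have he := ell_eq h (pt m ⟨k, hk⟩) (ofCoord m (μ ^ ·))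
    rw [ell_pt, hS _ le_rfl, hS _ hk, hS _ hk.le, hμ] at he
    rw [← mul_right_inj' h, ← he, Nat.succ_eq_add_one, pow_succ]
    field_simp
    ring

/-- Half of the argument of the `k`-th root `root m k` of `μ^d = ζ`. -/
noncomputable def halfArg (m k : ℕ) : ℝ := Real.pi * (k * (m + 1) - 1) / (m + 1) ^ 2

/-- The `k`-th root of `μ^d = ζ`, for `d = m + 1` and `α = 1 / d`; one takes `1 ≤ k ≤ d`. -/
noncomputable def root (m k : ℕ) : ℂ := Complex.exp (2 * halfArg m k * I)

theorem zeta_eq_exp (m : ℕ) :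
    zeta (1 / (m + 1 : ℕ)) = Complex.exp (-2 * (Real.pi / (m + 1) : ℝ) * I) := by
  rw [zeta, rho, ← Complex.exp_neg]
  congr 1
  push_cast
  ring

theorem root_pow (m k : ℕ) : root m k ^ (m + 1) = zeta (1 / (m + 1 : ℕ)) := by
  have hm : (m + 1 : ℂ) ≠ 0 := by exact_mod_cast Nat.succ_ne_zero m
  rw [root, ← Complex.exp_nat_mul, zeta_eq_exp, Complex.exp_eq_exp_iff_exists_int]
  refine ⟨k, ?_⟩
  rw [halfArg]
  push_cast
  field_simp
  ring

theorem exp_two_mul_sub_one (ψ : ℝ) :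
    Complex.exp (2 * ψ * I) - 1 = 2 * I * Real.sin ψ * Complex.exp (ψ * I) := by
  have h1 : Complex.exp (2 * ψ * I) = Complex.exp (ψ * I) * Complex.exp (ψ * I) := by
    rw [← Complex.exp_add]; congr 1; ring
  rw [h1, Complex.exp_mul_I]
  push_cast
  linear_combination Complex.sin_sq_add_cos_sq (ψ : ℂ) - Complex.sin ψ ^ 2 * I_sq

theorem exp_two_mul_add_one (ψ : ℝ) :
    1 + Complex.exp (2 * ψ * I) = 2 * Real.cos ψ * Complex.exp (ψ * I) := by
  have h1 : Complex.exp (2 * ψ * I) = Complex.exp (ψ * I) * Complex.exp (ψ * I) := by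
    rw [← Complex.exp_add]; congr 1; ring
  rw [h1, Complex.exp_mul_I]
  push_cast
  linear_combination -Complex.sin_sq_add_cos_sq (ψ : ℂ) + Complex.sin ψ ^ 2 * I_sq

/-- The eigenvalues of `Q_α` as quotients of sines. -/
theorem eigenvalue_eq (m k : ℕ) :
    (zeta (1 / (m + 1 : ℕ)) * root m k - 1) /
      ((root m k - 1) * (1 + zeta (1 / (m + 1 : ℕ)))) =
    ((Real.sin (halfArg m k - Real.pi / (m + 1)) /
      (2 * Real.sin (halfArg m k) * Real.cos (Real.pi / (m + 1))) : ℝ) : ℂ) := by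
  obtain ⟨β, hβ⟩ : ∃ β : ℝ, β = Real.pi / (m + 1) := ⟨_, rfl⟩
  have h1 : zeta (1 / (m + 1 : ℕ)) * root m k = Complex.exp (2 * (halfArg m k - β : ℝ) * I) := by
    rw [zeta_eq_exp, root, ← Complex.exp_add, hβ]
    congr 1
    push_cast
    ring
  have h2 : zeta (1 / (m + 1 : ℕ)) = Complex.exp (2 * (-β : ℝ) * I) := by
    rw [zeta_eq_exp, hβ]
    congr 1
    push_cast
    ring
  have h3 : Complex.exp ((halfArg m k - β : ℝ) * I) =
      Complex.exp (halfArg m k * I) * Complex.exp ((-β : ℝ) * I) := by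
    rw [← Complex.exp_add]
    congr 1
    push_cast
    ring
  rw [h1, h2, root, exp_two_mul_sub_one, exp_two_mul_sub_one, exp_two_mul_add_one, h3, ← hβ,
    Real.cos_neg]
  have e1 := Complex.exp_ne_zero (halfArg m k * I)
  have e2 := Complex.exp_ne_zero ((-β : ℝ) * I)
  push_cast at *
  rw [show 2 * I * Complex.sin (halfArg m k - β) *
      (Complex.exp (halfArg m k * I) * Complex.exp (-β * I)) =
    (2 * I * (Complex.exp (halfArg m k * I) * Complex.exp (-β * I))) *
      Complex.sin (halfArg m k - β) by ring,
    show 2 * I * Complex.sin (halfArg m k) * Complex.exp (halfArg m k * I) *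
      (2 * Complex.cos β * Complex.exp (-β * I)) =
    (2 * I * (Complex.exp (halfArg m k * I) * Complex.exp (-β * I))) *
      (2 * Complex.sin (halfArg m k) * Complex.cos β) by ring,
    mul_div_mul_left _ _ (mul_ne_zero (mul_ne_zero two_ne_zero I_ne_zero) (mul_ne_zero e1 e2))]

theorem cos_pos_of_two_le {m : ℕ} (hm : 2 ≤ m) : 0 < Real.cos (Real.pi / (m + 1)) := by
  have hm' : (2 : ℝ) ≤ m := by exact_mod_cast hm
  have : 0 < Real.pi / (m + 1) := by positivity
  refine Real.cos_pos_of_mem_Ioo ⟨by linarith [Real.pi_pos], ?_⟩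
  exact div_lt_div_of_pos_left Real.pi_pos (by norm_num) (by linarith)

theorem sin_halfArg_pos {m k : ℕ} (hm : 2 ≤ m) (hk : 1 ≤ k) (hk' : k ≤ m + 1) :
    0 < Real.sin (halfArg m k) := by
  have hm' : (2 : ℝ) ≤ m := by exact_mod_cast hm
  have h1 : (1 : ℝ) ≤ k := by exact_mod_cast hk
  have h2 : (k : ℝ) ≤ m + 1 := by exact_mod_cast hk'
  refine Real.sin_pos_of_pos_of_lt_pi ?_ ?_
  · rw [halfArg]
    have : 0 < (k : ℝ) * (m + 1) - 1 := by nlinarith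
    have := Real.pi_pos
    positivity
  · rw [halfArg, div_lt_iff₀ (by positivity)]
    have := Real.pi_pos
    gcongr
    nlinarith

/-- The eigenvalues after the first one are positive. -/
theorem sin_halfArg_sub {m k : ℕ} (hm : 2 ≤ m) (hk' : k < m) :
    0 < Real.sin (halfArg m (k + 2) - Real.pi / (m + 1)) := by
  have : halfArg m (k + 2) - Real.pi / (m + 1) = halfArg m (k + 1) := by
    rw [halfArg, halfArg]
    push_cast
    field_simp
    ring
  rw [this]
  exact sin_halfArg_pos hm (by omega) (by omega)

/-- The first eigenvalue is negative. -/
theorem sin_halfArg_one_sub {m : ℕ} (hm : 2 ≤ m) :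
    Real.sin (halfArg m 1 - Real.pi / (m + 1)) < 0 := by
  have : halfArg m 1 - Real.pi / (m + 1) = -(Real.pi / (m + 1) ^ 2) := by
    rw [halfArg]
    push_cast
    field_simp
    ring
  rw [this, Real.sin_neg, neg_lt_zero]
  have := Real.pi_pos
  refine Real.sin_pos_of_pos_of_lt_pi (by positivity) ?_
  have hm' : (2 : ℝ) ≤ m := by exact_mod_cast hm
  exact div_lt_self this (by nlinarith)

theorem root_ne_one {m k : ℕ} (hm : 2 ≤ m) (hk : 1 ≤ k) (hk' : k ≤ m + 1) : root m k ≠ 1 := by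
  intro h
  have h1 := exp_two_mul_sub_one (halfArg m k)
  rw [← root, h, sub_self] at h1
  have h2 : (Real.sin (halfArg m k) : ℂ) ≠ 0 := by
    exact_mod_cast (sin_halfArg_pos hm hk hk').ne'
  exact mul_ne_zero (mul_ne_zero (mul_ne_zero two_ne_zero I_ne_zero) h2) (Complex.exp_ne_zero _)
    h1.symm

theorem root_mul_conj (m k l : ℕ) :
    root m k * conj (root m l) =
      Complex.exp (2 * Real.pi * I * (((k : ℤ) - l : ℤ) / (m + 1 : ℕ))) := by
  rw [root, root, ← Complex.exp_conj, ← Complex.exp_add]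
  have hm : (m + 1 : ℂ) ≠ 0 := by exact_mod_cast Nat.succ_ne_zero m
  simp only [halfArg, map_mul, Complex.conj_ofNat, conj_ofReal, conj_I]
  congr 1
  push_cast
  field_simp
  ring

theorem sum_root_mul_conj {m k l : ℕ} (hk : 1 ≤ k) (hk' : k ≤ m + 1) (hl : 1 ≤ l)
    (hl' : l ≤ m + 1) : ∑ j ∈ Finset.range (m + 1), (root m k * conj (root m l)) ^ j =
      if k = l then (m + 1 : ℂ) else 0 := by
  split_ifs with h
  · subst h
    rw [root_mul_conj]
    simp
  · have hm : (m + 1 : ℂ) ≠ 0 := by exact_mod_cast Nat.succ_ne_zero m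
    have h1 : root m k * conj (root m l) ≠ 1 := by
      rw [root_mul_conj, Ne, Complex.exp_eq_one_iff]
      rintro ⟨n, hn⟩
      have h2 : ((k : ℤ) - l : ℤ) = n * (m + 1 : ℕ) := by
        have hpi : (2 * Real.pi * I : ℂ) ≠ 0 := by simp [Real.pi_ne_zero]
        have h3 : (((k : ℤ) - l : ℤ) : ℂ) / (m + 1 : ℕ) = n :=
          mul_left_cancel₀ hpi (by rw [hn]; ring)
        rw [div_eq_iff (by exact_mod_cast hm)] at h3
        exact_mod_cast h3
      have h4 : n = 0 := by
        by_contra hn0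
        rcases lt_or_gt_of_ne hn0 with hn0 | hn0
        · have : n * (m + 1 : ℕ) ≤ -1 * (m + 1 : ℕ) := by gcongr; omega
          push_cast at *
          omega
        · have : 1 * ((m + 1 : ℕ) : ℤ) ≤ n * (m + 1 : ℕ) := by gcongr; omega
          push_cast at *
          omega
      rw [h4] at h2
      omega
    rw [geom_sum_eq h1, mul_pow, ← map_pow, root_pow, root_pow, conj_zeta, zeta_mul_rho, sub_self,
      zero_div]

theorem formQ_root {m k l : ℕ} (hm : 2 ≤ m) (hk : 1 ≤ k) (hk' : k ≤ m + 1) (hl : 1 ≤ l)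
    (hl' : l ≤ m + 1) (hζ : 1 + zeta (1 / (m + 1 : ℕ)) ≠ 0) :
    formQ (1 / (m + 1 : ℕ)) (m + 1) (ofCoord m (root m k ^ ·)) (ofCoord m (root m l ^ ·)) =
      if k = l then (((m + 1) * (Real.sin (halfArg m k - Real.pi / (m + 1)) /
        (2 * Real.sin (halfArg m k) * Real.cos (Real.pi / (m + 1)))) : ℝ) : ℂ) else 0 := by
  rw [formQ_geom hζ (root_pow m k) (root_ne_one hm hk hk'), eigenvalue_eq,
    sum_root_mul_conj hk hk' hl hl']
  split_ifs
  · push_cast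
    ring
  · rw [mul_zero]

/-- For `α = 1 / d`, `d = m + 1 ≥ 3`, the form `Q_α` has signature `(m, 1)`. -/
theorem exists_equiv_formQ {m : ℕ} (hm : 2 ≤ m) (hζ : 1 + zeta (1 / (m + 1 : ℕ)) ≠ 0) :
    ∃ φ : (A (m + 1) → ℂ) ≃ₗ[ℂ] (Fin m ⊕ Fin 1 → ℂ),
      ∀ x y, formQ (1 / (m + 1 : ℕ)) (m + 1) x y = stdForm m 1 (φ x) (φ y) := by
  let K : Fin m ⊕ Fin 1 → ℕ := Sum.elim (fun i => i.1 + 2) fun _ => 1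
  have hK : ∀ i, 1 ≤ K i ∧ K i ≤ m + 1 := by
    rintro (i | i) <;> simp [K]
  have hKinj : ∀ i j, K i = K j ↔ i = j := by
    rintro (i | i) (j | j) <;> simp [K, Fin.ext_iff]
  let c : Fin m ⊕ Fin 1 → ℝ := fun i =>
    (m + 1) * (Real.sin (halfArg m (K i) - Real.pi / (m + 1)) /
        (2 * Real.sin (halfArg m (K i)) * Real.cos (Real.pi / (m + 1))))
  have hden : ∀ i, 0 < 2 * Real.sin (halfArg m (K i)) * Real.cos (Real.pi / (m + 1)) := fun i =>
    mul_pos (mul_pos two_pos (sin_halfArg_pos hm (hK i).1 (hK i).2)) (cos_pos_of_two_le hm)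
  have hc : ∀ i, c i = Sum.elim (fun _ => 1) (fun _ => -1) i * |c i| ∧ c i ≠ 0 := by
    have hm0 : (0 : ℝ) < m + 1 := by positivity
    rintro (i | i)
    · have : 0 < c (Sum.inl i) := mul_pos hm0 (div_pos (sin_halfArg_sub hm i.2) (hden _))
      exact ⟨by simp [abs_of_pos this], this.ne'⟩
    · have : c (Sum.inr i) < 0 :=
        mul_neg_of_pos_of_neg hm0 (div_neg_of_neg_of_pos (sin_halfArg_one_sub hm) (hden _))
      exact ⟨by simp [abs_of_neg this], this.ne⟩
  have hcard : Fintype.card (A (m + 1)) = m + 1 := by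
    rw [← Fintype.card_of_bijective (pt_bijective m), Fintype.card_fin]
  refine exists_equiv_stdForm hcard
    (fun i => ((√|c i|)⁻¹ : ℂ) • ofCoord m (root m (K i) ^ ·)) fun i j => ?_
  rw [LinearMap.map_smulₛₗ, LinearMap.map_smul, LinearMap.smul_apply,
    formQ_root hm (hK i).1 (hK i).2 (hK j).1 (hK j).2 hζ]
  simp only [hKinj]
  split_ifs with h
  · subst h
    have h0 : |c i| ≠ 0 := abs_ne_zero.mpr (hc i).2
    have h1 : (√|c i|)⁻¹ * ((√|c i|)⁻¹ * c i) = Sum.elim (fun _ => 1) (fun _ => -1) i := by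
      rw [← mul_assoc, ← mul_inv, Real.mul_self_sqrt (abs_nonneg _), inv_mul_eq_div,
        div_eq_iff h0]
      exact (hc i).1
    have h2 : ((Sum.elim (fun _ => 1) (fun _ => -1) i : ℝ) : ℂ) =
        Sum.elim (fun _ => 1) (fun _ => -1) i := by
      rcases i with i | i <;> simp
    rw [← h2, ← h1]
    simp [c]
  · simp

end Signature

/-! ### Zariski density -/

section Density

/-- The group `Γ ∩ SL`. -/
noncomputable def gamSL (α : ℝ) (d : ℕ) : Subgroup (GL (A d) ℂ) :=
  Gam α d ⊓ GeneralLinearGroup.det.ker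

theorem mem_gamSL {α : ℝ} {d : ℕ} {g : GL (A d) ℂ} :
    g ∈ gamSL α d ↔ g ∈ Gam α d ∧ g.1.det = 1 := by
  rw [gamSL, Subgroup.mem_inf, MonoidHom.mem_ker, Units.ext_iff]
  rfl

theorem gamSL_le_SU {α : ℝ} (h : 1 + zeta α ≠ 0) (d : ℕ) :
    gamSL α d ≤ SU fun x y => formQ α d x y := fun _ hg =>
  ⟨formQ_Gam h (mem_gamSL.mp hg).1, (mem_gamSL.mp hg).2⟩

theorem formQ_nullVec {α : ℝ} {m : ℕ} (hd : rho α ^ (m + 1) = 1) (hρ : (rho α).im ≠ 0)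
    (x : A (m + 1) → ℂ) :
    (1 + zeta α) * formQ α (m + 1) x (nullVec α m) = -rho α * coord x m := by
  have h := one_add_zeta_ne_zero hρ
  have hρ1 : rho α ≠ 1 := fun h1 => hρ (by rw [h1]; simp)
  have hz := zeta_mul_rho α
  have h1 : formQ α (m + 1) (nullVec α m) x = conj (coord x m) * (-zeta α ^ 2 / (1 + zeta α)) := by
    rw [formQ_eq_sum α _ _ fun k => if k = m then -zeta α ^ 2 / (1 + zeta α) else 0,
      Finset.sum_eq_single m (fun k _ hk => by simp [hk]) (by simp)]
    · simp
    · intro k hk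
      have := ell_eq h (pt m ⟨k, hk⟩) (nullVec α m)
      rw [ell_nullVec hd hρ1] at this
      split_ifs at this ⊢
      · rw [this, mul_div_cancel_left₀ _ h]
      · exact (mul_eq_zero.mp this.symm).resolve_left h
  have h' : 1 + rho α ≠ 0 := fun h0 => h (by linear_combination zeta α * h0 - hz)
  rw [← formQ_conj, h1]
  simp only [map_mul, map_div₀, map_neg, map_pow, map_add, map_one, conj_zeta, conj_conj]
  field_simp
  linear_combination -rho α * coord x m * hz

/-- The power `(L_0 ⋯ L_{m-1}) ^ d` is a nontrivial unitary transvection. -/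
theorem toLin'_prodL_pow {α : ℝ} {m : ℕ} (hd : rho α ^ (m + 1) = 1) (hρ : (rho α).im ≠ 0) :
    Matrix.toLin' (prodL α m m ^ (m + 1)).1 =
      transv (formQ α (m + 1)) (nullVec α m) (2 * (rho α).im) := by
  have h := one_add_zeta_ne_zero hρ
  have hz := zeta_mul_rho α
  refine LinearMap.ext fun x => coord_ext fun n hn => ?_
  rw [Matrix.toLin'_apply, coord_prodL_pow hd x hn, transv_apply, coord_add, coord_smul]
  have h1 : ((2 * (rho α).im : ℝ) : ℂ) * I = rho α - zeta α := by
    rw [← conj_rho]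
    apply Complex.ext <;> simp
    ring
  rw [h1]
  have h2 := formQ_nullVec hd hρ x
  have h3 : (rho α - zeta α) * formQ α (m + 1) x (nullVec α m) =
      rho α * (1 - rho α) * coord x m := by
    linear_combination (rho α - 1) * h2 - formQ α (m + 1) x (nullVec α m) * hz
  rw [h3]

theorem formQ_nullVec_self {α : ℝ} {m : ℕ} (hd : rho α ^ (m + 1) = 1) (hρ : (rho α).im ≠ 0) :
    formQ α (m + 1) (nullVec α m) (nullVec α m) = 0 := by
  have h := formQ_nullVec hd hρ (nullVec α m)
  rw [coord_nullVec α le_rfl, if_neg (lt_irrefl m), mul_zero] at h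
  exact (mul_eq_zero.mp h).resolve_left (one_add_zeta_ne_zero hρ)

/-- The orbit of `nullVec` under `Γ` consists of isotropic vectors with transvections in the Zariski
closure of `Γ ∩ SL`. -/
theorem mulVec_nullVec_mem {α : ℝ} {m : ℕ} (hd : rho α ^ (m + 1) = 1) (hρ : (rho α).im ≠ 0)
    {g : GL (A (m + 1)) ℂ} (hg : g ∈ Gam α (m + 1)) :
    g.1 *ᵥ nullVec α m ∈ nullVectors (formQ α (m + 1)) (zariskiClosure (gamSL α (m + 1))) := by
  have hiso := formQ_Gam (one_add_zeta_ne_zero hρ) hg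
  have hnull : formQ α (m + 1) (g.1 *ᵥ nullVec α m) (g.1 *ᵥ nullVec α m) = 0 := by
    rw [hiso, formQ_nullVec_self hd hρ]
  refine ⟨hnull, transv_mem_zariskiClosure hnull (mul_ne_zero two_ne_zero hρ) ?_⟩
  have hconj : transv (formQ α (m + 1)) (g.1 *ᵥ nullVec α m) (2 * (rho α).im) =
      Matrix.toLin' (g * prodL α m m ^ (m + 1) * g⁻¹).1 := by
    have h1 : Matrix.toLin' g.1 * Matrix.toLin' (g⁻¹).1 = 1 := by
      have h2 := Matrix.toLin'_mul g.1 (g⁻¹).1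
      rw [Units.mul_inv, Matrix.toLin'_one] at h2
      exact h2.symm
    have := mul_transv_mul (B := formQ α (m + 1)) (g := Matrix.toLin' g.1)
      (h := Matrix.toLin' (g⁻¹).1) hiso h1 (nullVec α m) (2 * (rho α).im)
    rw [Matrix.toLin'_apply] at this
    rw [← this, ← toLin'_prodL_pow hd hρ, Units.val_mul, Units.val_mul, Matrix.toLin'_mul,
      Matrix.toLin'_mul]
    rfl
  rw [hconj]
  refine toLin'_mem_zariskiClosure (mem_gamSL.mpr ⟨?_, ?_⟩)
  · exact mul_mem (mul_mem hg (pow_mem (prodL_mem_Gam α m m) _)) (inv_mem hg)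
  · rw [← LinearMap.det_toLin', ← hconj, det_transv hnull]

/-- The vectors `v`, `L_m v` and `L_p L_m v` of the orbit of `v = nullVec α m` span the space. -/
theorem span_nullVectors {α : ℝ} {m : ℕ} (hd : rho α ^ (m + 1) = 1) (hρ : (rho α).im ≠ 0) :
    Submodule.span ℂ (nullVectors (formQ α (m + 1)) (zariskiClosure (gamSL α (m + 1)))) = ⊤ := by
  have hρ1 : rho α ≠ 1 := fun h1 => hρ (by rw [h1]; simp)
  have hζ0 : zeta α ≠ 0 := left_ne_zero_of_mul_eq_one (zeta_mul_rho α)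
  let W := Submodule.span ℂ (nullVectors (formQ α (m + 1)) (zariskiClosure (gamSL α (m + 1))))
  have hL : ∀ p : A (m + 1), L α p ∈ Gam α (m + 1) := fun p => Subgroup.subset_closure ⟨p, rfl⟩
  have hW : ∀ g ∈ Gam α (m + 1), g.1 *ᵥ nullVec α m ∈ W := fun g hg =>
    Submodule.subset_span (mulVec_nullVec_mem hd hρ hg)
  have h0 : nullVec α m ∈ W := by simpa using hW 1 (one_mem _)
  -- the difference of `L_p x` and `x` is a multiple of `e_p`
  have hmem : ∀ (p : A (m + 1)) (x : A (m + 1) → ℂ), x ∈ W → (L α p).1 *ᵥ x ∈ W →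
      ell α p x ≠ 0 → e p ∈ W := fun p x hx hLx hp => by
    rw [L_mulVec] at hLx
    have := sub_mem hx hLx
    rw [sub_sub_cancel] at this
    exact (Submodule.smul_mem_iff _ hp).mp this
  have hlast := ell_nullVec hd hρ1 (Nat.lt_succ_self m)
  rw [if_pos rfl] at hlast
  have hm : e (pt m ⟨m, Nat.lt_succ_self m⟩) ∈ W :=
    hmem _ _ h0 (hW _ (hL _)) (by rw [hlast]; simpa using hζ0)
  have he : ∀ p : A (m + 1), e p ∈ W := by
    intro p
    obtain ⟨⟨k, hk⟩, rfl⟩ := (pt_bijective m).2 p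
    by_cases hkm : k = m
    · subst hkm
      exact hm
    · refine hmem _ ((L α (pt m ⟨m, Nat.lt_succ_self m⟩)).1 *ᵥ nullVec α m) (hW _ (hL _)) ?_ ?_
      · rw [mulVec_mulVec, ← Units.val_mul]
        exact hW _ (mul_mem (hL _) (hL _))
      · have h1 : ell α (pt m ⟨k, hk⟩) (e (pt m ⟨m, Nat.lt_succ_self m⟩)) = 1 := by
          have : pt m ⟨k, hk⟩ < pt m ⟨m, Nat.lt_succ_self m⟩ :=
            pt_lt_pt.mpr (Fin.mk_lt_mk.mpr (by omega))
          simp only [ell, e, Pi.single_apply]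
          rw [Finset.sum_eq_single (pt m ⟨m, Nat.lt_succ_self m⟩)
            (fun q _ hq => by simp [hq]) (by simp)]
          simp [this]
        have h2 := ell_nullVec hd hρ1 hk
        rw [if_neg hkm] at h2
        have h := one_add_zeta_ne_zero hρ
        rw [L_mulVec, hlast, ell_eq h, map_sub, map_smul, LinearMap.sub_apply,
          LinearMap.smul_apply, mul_sub, smul_eq_mul, mul_left_comm, ← ell_eq h, ← ell_eq h, h1, h2]
        simpa using hζ0
  rw [eq_top_iff]
  intro x _
  have hx : x = ∑ p, x p • (e p : A (m + 1) → ℂ) := pi_eq_sum_univ' x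
  rw [hx]
  exact Submodule.sum_mem _ fun p _ => Submodule.smul_mem _ _ (he p)

theorem rho_pow_eq_one (m : ℕ) : rho (1 / (m + 1 : ℕ)) ^ (m + 1) = 1 := by
  have hm : (m + 1 : ℂ) ≠ 0 := by exact_mod_cast Nat.succ_ne_zero m
  rw [rho, ← Complex.exp_nat_mul, ← Complex.exp_two_pi_mul_I]
  congr 1
  push_cast
  field_simp

theorem rho_im_ne_zero {m : ℕ} (hm : 2 ≤ m) : (rho (1 / (m + 1 : ℕ))).im ≠ 0 := by
  have hm' : (2 : ℝ) ≤ m := by exact_mod_cast hm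
  have h : rho (1 / (m + 1 : ℕ)) = Complex.exp ((2 * Real.pi / (m + 1) : ℝ) * I) := by
    rw [rho]
    congr 1
    push_cast
    ring
  have := Real.pi_pos
  rw [h, Complex.exp_ofReal_mul_I_im]
  refine (Real.sin_pos_of_pos_of_lt_pi (by positivity) ?_).ne'
  rw [div_lt_iff₀ (by positivity)]
  nlinarith

/-- For `α = 1 / d` and every `d = m + 1 ≥ 3`, the group `Γ ∩ SL` is Zariski dense
in `SU(Q_α) ≅ SU(d - 1, 1)`. -/
theorem isZariskiDenseIn_and_isStandardSU {m : ℕ} (hm : 2 ≤ m) {α : ℝ} (hα : α = 1 / (m + 1 : ℕ)) :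
    IsZariskiDenseIn {g : GL (A (m + 1)) ℂ | g ∈ Gam α (m + 1) ∧ g.1.det = 1}
      (SU (Q α (m + 1))) ∧ IsStandardSU (Q α (m + 1)) m 1 := by
  subst hα
  have hd := rho_pow_eq_one m
  have hρ := rho_im_ne_zero hm
  have hζ := one_add_zeta_ne_zero hρ
  obtain ⟨φ, hφ⟩ := exists_equiv_formQ hm hζ
  refine ⟨?_, isStandardSU_of_equiv φ hφ⟩
  have hset : {g : GL (A (m + 1)) ℂ | g ∈ Gam (1 / (m + 1 : ℕ)) (m + 1) ∧ g.1.det = 1} =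
      (gamSL (1 / (m + 1 : ℕ)) (m + 1) : Set (GL (A (m + 1)) ℂ)) :=
    Set.ext fun g => mem_gamSL.symm
  rw [hset]
  exact isZariskiDenseIn_of_span (by omega) φ hφ (gamSL_le_SU hζ _) (span_nullVectors hd hρ)

end Density

end VeechMcMullen

theorem mainTheorem9 :
    (VeechMcMullen.IsZariskiDenseIn
        {g : GL (VeechMcMullen.A 4) ℂ | g ∈ VeechMcMullen.Gam (1 / 4) 4 ∧ g.1.det = 1}
        (VeechMcMullen.SU (VeechMcMullen.Q (1 / 4) 4)) ∧
      VeechMcMullen.IsStandardSU (VeechMcMullen.Q (1 / 4) 4) 3 1) ∧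
    (VeechMcMullen.IsZariskiDenseIn
        {g : GL (VeechMcMullen.A 6) ℂ | g ∈ VeechMcMullen.Gam (1 / 6) 6 ∧ g.1.det = 1}
        (VeechMcMullen.SU (VeechMcMullen.Q (1 / 6) 6)) ∧
      VeechMcMullen.IsStandardSU (VeechMcMullen.Q (1 / 6) 6) 5 1) :=
  ⟨VeechMcMullen.isZariskiDenseIn_and_isStandardSU (m := 3) (by norm_num) (by norm_num),
    VeechMcMullen.isZariskiDenseIn_and_isStandardSU (m := 5) (by norm_num) (by norm_num)⟩
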